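/- Let $M$ be a paracompact Hausdorff smooth ($C^\infty$) real manifold of dimension $n\ge 0$, and let $\mathfrak X(M)$ denote its smooth vector fields. An \emph{affine atlas} of $M$ is a set $\{(U_\alpha,\varphi_\alpha)\}_{\alpha\in J}$ of smooth charts $\varphi_\alpha:U_\alpha\to\mathbb R^n$ of $M$ with $\bigcup_\alpha U_\alpha=M$ such that for all $\alpha,\beta\in J$ there is an invertible affine transformation $\sigma_{\alpha\beta}$ of $\mathbb R^n$ with $\varphi_\beta\circ\varphi_\alpha^{-1}=\sigma_{\alpha\beta}$ on $\varphi_\alpha(U_\alpha\cap U_\beta)$; $M$ \emph{admits an affine structure} if it has an affine atlas that is maximal, with respect to inclusion, among its affine atlases. \textbf{Theorem (Auslander--Markus).} $M$ admits an affine structure if and only if there is a smooth linear connection $\nabla$ on the tangent bundle $TM$ that is torsion-free and flat, i.e. such that $$\nabla_XY-\nabla_YX-[X,Y]=0\quad\text{and}\quad \nabla_X\nabla_YZ-\nabla_Y\nabla_XZ-\nabla_{[X,Y]}Z=0\quad\text{for all } X,Y,Z\in\mathfrak X(M).$$ -/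

import Mathlib

open scoped Manifold ContDiff

/-- The curvature `R(X, Y) Z = ∇_X ∇_Y Z - ∇_Y ∇_X Z - ∇_[X, Y] Z` of a linear connection on the
tangent bundle, evaluated at the point `x`. Here `∇_X Y` at `x` is written `cov Y x (X x)`. -/
noncomputable def CovariantDerivative.curvatureAt
    {E : Type*} [NormedAddCommGroup E] [NormedSpace ℝ E]
    {H : Type*} [TopologicalSpace H] {I : ModelWithCorners ℝ E H}
    {M : Type*} [TopologicalSpace M] [ChartedSpace H M] [IsManifold I 1 M]
    (cov : CovariantDerivative I E (TangentSpace I : M → Type _))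
    (X Y Z : Π x : M, TangentSpace I x) (x : M) : TangentSpace I x :=
  cov (fun y ↦ cov Z y (Y y)) x (X x) - cov (fun y ↦ cov Z y (X y)) x (Y x)
    - cov Z x (VectorField.mlieBracket I X Y x)

/-- A linear connection is flat if `R(X, Y) Z = 0` for all smooth vector fields `X`, `Y`, `Z`. -/
def CovariantDerivative.IsFlat
    {E : Type*} [NormedAddCommGroup E] [NormedSpace ℝ E]
    {H : Type*} [TopologicalSpace H] {I : ModelWithCorners ℝ E H}
    {M : Type*} [TopologicalSpace M] [ChartedSpace H M] [IsManifold I 1 M]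
    (cov : CovariantDerivative I E (TangentSpace I : M → Type _)) : Prop :=
  ∀ X Y Z : Π x : M, TangentSpace I x,
    ContMDiff I I.tangent ∞ (fun x ↦ (⟨x, X x⟩ : TangentBundle I M)) →
    ContMDiff I I.tangent ∞ (fun x ↦ (⟨x, Y x⟩ : TangentBundle I M)) →
    ContMDiff I I.tangent ∞ (fun x ↦ (⟨x, Z x⟩ : TangentBundle I M)) →
    ∀ x : M, cov.curvatureAt X Y Z x = 0

/-- A set `A` of charts is an affine atlas of the smooth `n`-manifold `M` if its members belong to
the smooth structure of `M`, their domains cover `M`, and every change of coordinates `e' ∘ e⁻¹`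
is, on the whole of its domain `e (U ∩ U')`, the restriction of one affine transformation
of `ℝⁿ`. -/
structure IsAffineAtlas (n : ℕ) (M : Type*) [TopologicalSpace M]
    [ChartedSpace (EuclideanSpace ℝ (Fin n)) M]
    (A : Set (OpenPartialHomeomorph M (EuclideanSpace ℝ (Fin n)))) : Prop where
  smooth : A ⊆ IsManifold.maximalAtlas (𝓡 n) ∞ M
  cover : ∀ p : M, ∃ e ∈ A, p ∈ e.source
  affine : ∀ e ∈ A, ∀ e' ∈ A,
    ∃ σ : EuclideanSpace ℝ (Fin n) ≃ᵃ[ℝ] EuclideanSpace ℝ (Fin n),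
      Set.EqOn (e' ∘ e.symm) σ (e '' (e.source ∩ e'.source))

/-- `M` admits an affine structure: there is an affine atlas of `M` that is maximal (with respect
to inclusion) among the affine atlases of `M`. -/
def AdmitsAffineStructure (n : ℕ) (M : Type*) [TopologicalSpace M]
    [ChartedSpace (EuclideanSpace ℝ (Fin n)) M] : Prop :=
  ∃ A : Set (OpenPartialHomeomorph M (EuclideanSpace ℝ (Fin n))), Maximal (IsAffineAtlas n M) A

/-! In a chart, differentiating the components of vector fields is a torsion-free flat connection,
`flatCov`. The connections of two charts with transition map τ differ by D²τ
(`chartDeriv_flatCov_transition`), so affine transitions leave it unchanged and an affine atlas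
glues to a global ∇. Torsion vanishes by the coordinate formula for the Lie bracket, curvature by
symmetry of second derivatives.

Conversely, let Γ be the Christoffel symbols of ∇ in a chart. A coordinate change φ makes them
vanish when D²φ(v, w) = Dφ(Γ(v, w)). With θ = Dφ this is the linear total differential equation dθ =
θΓ, whose integrability condition is zero curvature (`exists_hasFDerivAt_of_integrable`). Zero
torsion makes Γ symmetric, hence θ closed, hence a derivative
(`exists_contDiffOn_fderiv_fderiv_eq`). Between the resulting charts D²τ = 0, so τ is affine on
connected sets.

Overlaps may be disconnected, yet an affine atlas wants a single affine map on each. Paracompactness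
allows connected domains so small that any two that meet lie in a common flat chart
(`exists_nhds_pairwise_refinement`). Zorn's lemma makes the atlas maximal. -/

namespace AffineStructure

open Set Metric Topology VectorField

/-! ### Linear total differential equations -/

section Pfaffian

/-- Grönwall with constant 1 on [0, 1]: the bound is δeᵗ + ε(eᵗ - 1), and 3 stands for e. -/
theorem norm_le_of_norm_deriv_le {F : Type*} [NormedAddCommGroup F] [NormedSpace ℝ F]
    {f f' : ℝ → F} {δ ε : ℝ}
    (hf : ∀ t ∈ Icc (0 : ℝ) 1, HasDerivWithinAt f (f' t) (Icc 0 1) t)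
    (h0 : ‖f 0‖ ≤ δ) (hε : 0 ≤ ε)
    (bound : ∀ t ∈ Icc (0 : ℝ) 1, ‖f' t‖ ≤ ‖f t‖ + ε) :
    ∀ t ∈ Icc (0 : ℝ) 1, ‖f t‖ ≤ 3 * (δ + ε) := by
  intro t ht
  have hδ : 0 ≤ δ := (norm_nonneg _).trans h0
  have key := norm_le_gronwallBound_of_norm_deriv_right_le (f := f) (f' := f') (δ := δ) (K := 1)
    (ε := ε) (a := 0) (b := 1) (fun s hs ↦ (hf s hs).continuousWithinAt)
    (fun s hs ↦ (hf s ⟨hs.1, hs.2.le⟩).mono_of_mem_nhdsWithin (Icc_mem_nhdsGE_of_mem hs)) h0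
    (fun s hs ↦ by simpa using bound s ⟨hs.1, hs.2.le⟩) t ht
  rw [gronwallBound_of_K_ne_0 one_ne_zero] at key
  have h3 : Real.exp t ≤ 3 :=
    (Real.exp_le_exp.2 ht.2).trans Real.exp_one_lt_three.le
  simp only [one_mul, sub_zero, div_one] at key
  nlinarith

variable {E R : Type*} [NormedAddCommGroup E] [NormedSpace ℝ E] [NormedRing R] [NormedAlgebra ℝ R]

theorem exists_linear_ode_solution [CompleteSpace R] {B : ℝ → R}
    (hB : ContinuousOn B (Icc 0 1))
    (hB' : ∀ t ∈ Icc (0 : ℝ) 1, ‖B t‖ ≤ 1 / 2) (φ₀ : R) :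
    ∃ φ : ℝ → R, φ 0 = φ₀ ∧
      ∀ t ∈ Icc (0 : ℝ) 1, HasDerivWithinAt φ (φ t * B t) (Icc 0 1) t := by
  -- In the ball of radius ‖φ₀‖ about φ₀ one has ‖φ‖ ≤ 2‖φ₀‖, so the speed is at most ‖φ₀‖ and the
  -- solution stays in the ball up to time 1.
  have hP : IsPicardLindelof (fun t φ ↦ φ * B t) (⟨0, by simp⟩ : Icc (0 : ℝ) 1) φ₀ ‖φ₀‖₊ 0
      ‖φ₀‖₊ 1 :=
    { lipschitzOnWith := fun t ht ↦ by
        refine (LipschitzWith.of_dist_le_mul fun x y ↦ ?_).lipschitzOnWith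
        rw [dist_eq_norm, dist_eq_norm, ← sub_mul, NNReal.coe_one, one_mul]
        have h1 := norm_mul_le (x - y) (B t)
        nlinarith [hB' t ht, norm_nonneg (x - y)]
      continuousOn := fun x _ ↦ continuousOn_const.mul hB
      norm_le := fun t ht x hx ↦ by
        have h1 : ‖x‖ ≤ ‖φ₀‖ + ‖φ₀‖ := by
          have := norm_le_norm_add_norm_sub' x φ₀
          rw [mem_closedBall, dist_eq_norm] at hx
          simp only [coe_nnnorm] at hx
          linarith
        have h2 := norm_mul_le x (B t)
        simp only [coe_nnnorm]
        nlinarith [hB' t ht, norm_nonneg x]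
      mul_max_le := by simp }
  exact hP.exists_eq_forall_mem_Icc_hasDerivWithinAt₀

theorem add_smul_mem_ball {x₀ h : E} {r t : ℝ} (hh : ‖h‖ < r) (ht : t ∈ Icc (0 : ℝ) 1) :
    x₀ + t • h ∈ ball x₀ r := by
  rw [mem_ball, dist_eq_norm, add_sub_cancel_left, norm_smul, Real.norm_eq_abs, abs_of_nonneg ht.1]
  exact lt_of_le_of_lt (mul_le_of_le_one_left (norm_nonneg _) ht.2) hh

theorem norm_apply_le_half {a : E → E →L[ℝ] R} {x₀ : E} {r K : ℝ}
    (hK : ∀ x ∈ ball x₀ r, ‖a x‖ ≤ K) (hKr : K * r ≤ 1 / 2)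
    {h : E} (hh : ‖h‖ < r) {t : ℝ} (ht : t ∈ Icc (0 : ℝ) 1) : ‖a (x₀ + t • h) h‖ ≤ 1 / 2 := by
  have h0 := hK _ (add_smul_mem_ball hh ht)
  have h1 := (a (x₀ + t • h)).le_of_opNorm_le h0 h
  have hK0 : 0 ≤ K := le_trans (norm_nonneg _) h0
  nlinarith

/-- Radial solution of the linear total differential equation `du_x(v) = u(x) a_x(v)`. -/
theorem exists_radial_solution [CompleteSpace R] {a : E → E →L[ℝ] R} {x₀ : E} {r K : ℝ}
    (hr : 0 < r) (hc : ContinuousOn a (ball x₀ r)) (hK : ∀ x ∈ ball x₀ r, ‖a x‖ ≤ K)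
    (hKr : K * r ≤ 1 / 2) (φ₀ : R) :
    ∃ u : E → R, u x₀ = φ₀ ∧ ∀ h : E, ‖h‖ < r → ∀ t ∈ Icc (0 : ℝ) 1,
      HasDerivWithinAt (fun t : ℝ ↦ u (x₀ + t • h))
        (u (x₀ + t • h) * a (x₀ + t • h) h) (Icc 0 1) t := by
  have hcont : ∀ h : E, ‖h‖ < r → ContinuousOn (fun t : ℝ ↦ a (x₀ + t • h) h) (Icc 0 1) := by
    intro h hh
    refine ContinuousOn.clm_apply (hc.comp (by fun_prop) fun t ht ↦ add_smul_mem_ball hh ht)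
      continuousOn_const
  have hex : ∀ h : E, ∃ φ : ℝ → R, φ 0 = φ₀ ∧ (‖h‖ < r → ∀ t ∈ Icc (0 : ℝ) 1,
      HasDerivWithinAt φ (φ t * a (x₀ + t • h) h) (Icc 0 1) t) := by
    intro h
    by_cases hh : ‖h‖ < r
    · obtain ⟨φ, h0, h1⟩ := exists_linear_ode_solution (hcont h hh)
        (fun t ht ↦ norm_apply_le_half hK hKr hh ht) φ₀
      exact ⟨φ, h0, fun _ ↦ h1⟩
    · exact ⟨fun _ ↦ φ₀, rfl, fun h ↦ absurd h hh⟩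
  choose Φ hΦ0 hΦ using hex
  -- Slowing the solution along h by the factor s solves the equation along s • h with the same
  -- initial value; Grönwall with zero data gives uniqueness. Hence the time-one values form one
  -- function whose restriction to each ray is the solution there.
  have key : ∀ h : E, ‖h‖ < r → ∀ s ∈ Icc (0 : ℝ) 1, Φ (s • h) 1 = Φ h s := by
    intro h hh s hs
    have hsh : ‖s • h‖ < r := by
      rw [norm_smul, Real.norm_eq_abs, abs_of_nonneg hs.1]
      exact lt_of_le_of_lt (mul_le_of_le_one_left (norm_nonneg _) hs.2) hh
    have hst : MapsTo (fun t : ℝ ↦ s * t) (Icc 0 1) (Icc 0 1) := fun t ht ↦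
      ⟨mul_nonneg hs.1 ht.1, mul_le_one₀ hs.2 ht.1 ht.2⟩
    have h2 : ∀ t ∈ Icc (0 : ℝ) 1, HasDerivWithinAt (fun t ↦ Φ h (s * t))
        (Φ h (s * t) * a (x₀ + t • s • h) (s • h)) (Icc 0 1) t := by
      intro t ht
      have := (hΦ h hh (s * t) (hst ht)).scomp t
        (((hasDerivAt_id t).const_mul s).hasDerivWithinAt) hst
      have e : Φ h (s * t) * a (x₀ + t • s • h) (s • h) =
          (s * 1) • (Φ h (s * t) * a (x₀ + (s * t) • h) h) := by
        simp [smul_smul, mul_comm t]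
      rw [e]
      exact this
    have h3 := norm_le_of_norm_deriv_le (δ := 0) (ε := 0)
      (fun t ht ↦ (hΦ (s • h) hsh t ht).sub (h2 t ht)) (by simp [hΦ0]) le_rfl (fun t ht ↦ by
        rw [← sub_mul]
        have h1 := norm_mul_le (Φ (s • h) t - Φ h (s * t)) (a (x₀ + t • s • h) (s • h))
        have h0 := norm_nonneg (Φ (s • h) t - Φ h (s * t))
        have := norm_apply_le_half hK hKr hsh ht
        simp only [Pi.sub_apply, add_zero]
        nlinarith) 1 (by simp)
    have h4 : Φ (s • h) 1 - Φ h (s * 1) = 0 := norm_le_zero_iff.1 (by simpa using h3)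
    simpa [sub_eq_zero] using h4
  refine ⟨fun x ↦ Φ (x - x₀) 1, ?_, fun h hh t ht ↦ ?_⟩
  · have := key 0 (by simpa using hr) 0 (by simp)
    rw [smul_zero] at this
    simp [this, hΦ0]
  · simp only [add_sub_cancel_left]
    rw [key h hh t ht]
    exact (hΦ h hh t ht).congr (fun s hs ↦ key h hh s hs) (key h hh t ht)

/-- A linear total differential equation `du_x(v) = u(x) a_x(v)` whose integrability condition
holds has solutions with arbitrary initial values. -/
theorem exists_hasFDerivAt_of_integrable [CompleteSpace R] {a : E → E →L[ℝ] R}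
    {a' : E → E →L[ℝ] E →L[ℝ] R} {x₀ : E} {r K K' L : ℝ} (hr : 0 < r)
    (ha : ∀ x ∈ ball x₀ r, HasFDerivAt a (a' x) x)
    (hK : ∀ x ∈ ball x₀ r, ‖a x‖ ≤ K) (hK' : ∀ x ∈ ball x₀ r, ‖a' x‖ ≤ K')
    (hL : ∀ x ∈ ball x₀ r, ∀ y ∈ ball x₀ r, ‖a' x - a' y‖ ≤ L * ‖x - y‖)
    (hKr : K * r ≤ 1 / 2)
    (hint : ∀ x ∈ ball x₀ r, ∀ v w : E,
      a' x v w + a x v * a x w = a' x w v + a x w * a x v)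
    (φ₀ : R) :
    ∃ u : E → R, u x₀ = φ₀ ∧
      ∀ x ∈ ball x₀ r, HasFDerivAt u ((ContinuousLinearMap.mul ℝ R (u x)).comp (a x)) x := by
  have hx₀ : x₀ ∈ ball x₀ r := mem_ball_self hr
  have hK0 : 0 ≤ K := le_trans (norm_nonneg (a x₀)) (hK _ hx₀)
  have hK'0 : 0 ≤ K' := (ContinuousLinearMap.opNorm_nonneg (a' x₀)).trans (hK' _ hx₀)
  obtain ⟨u, hu0, hu⟩ := exists_radial_solution hr
    (fun x hx ↦ (ha x hx).continuousAt.continuousWithinAt) hK hKr φ₀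
  refine ⟨u, hu0, fun x hx ↦ ?_⟩
  -- the solution is bounded
  have hC : ∀ h : E, ‖h‖ < r → ∀ t ∈ Icc (0 : ℝ) 1, ‖u (x₀ + t • h)‖ ≤ 3 * ‖φ₀‖ := by
    intro h hh t ht
    have := norm_le_of_norm_deriv_le (δ := ‖φ₀‖) (ε := 0) (hu h hh) (by simp [hu0]) le_rfl
      (fun s hs ↦ by
        have h1 := norm_mul_le (u (x₀ + s • h)) (a (x₀ + s • h) h)
        nlinarith [norm_apply_le_half hK hKr hh hs, norm_nonneg (u (x₀ + s • h))]) t ht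
    simpa using this
  -- first and second order estimates for the coefficients
  have hseg : ∀ y ∈ ball x₀ r, ∀ z ∈ ball x₀ r, segment ℝ y z ⊆ ball x₀ r := fun y hy z hz ↦
    (convex_ball x₀ r).segment_subset hy hz
  have ha1 : ∀ y ∈ ball x₀ r, ∀ z ∈ ball x₀ r, ‖a z - a y‖ ≤ K' * ‖z - y‖ := fun y hy z hz ↦
    (convex_ball x₀ r).norm_image_sub_le_of_norm_hasFDerivWithin_le
      (fun w hw ↦ (ha w hw).hasFDerivWithinAt) hK' hy hz
  have ha2 : ∀ y ∈ ball x₀ r, ∀ z ∈ ball x₀ r,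
      ‖a z - a y - a' y (z - y)‖ ≤ |L| * ‖z - y‖ * ‖z - y‖ := by
    intro y hy z hz
    refine (convex_segment y z).norm_image_sub_le_of_norm_hasFDerivWithin_le'
      (fun w hw ↦ (ha w (hseg y hy z hz hw)).hasFDerivWithinAt) (fun w hw ↦ ?_)
      (left_mem_segment ℝ y z) (right_mem_segment ℝ y z)
    have h2 : ‖w - y‖ ≤ ‖z - y‖ := norm_sub_le_of_mem_segment hw
    calc _ ≤ L * ‖w - y‖ := hL w (hseg y hy z hz hw) y hy
      _ ≤ |L| * ‖w - y‖ := by gcongr; exact le_abs_self L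
      _ ≤ _ := by gcongr
  set h := x - x₀ with hh_def
  have hxh : x = x₀ + h := by simp [hh_def]
  have hh : ‖h‖ < r := by simpa [dist_eq_norm] using hx
  set C := 3 * ‖φ₀‖ with hC_def
  have hC0 : 0 ≤ C := by positivity
  -- the quadratic estimate
  set C₁ := (K' * r * C + K * C) with hC₁
  have hC₁0 : 0 ≤ C₁ := by positivity
  set C₂ := C * (|L| * r) + 3 * C₁ * (K' * r) + C * K' + 3 * C₁ * K with hC₂
  have hquad : ∀ k : E, ‖h + k‖ < r →
      ‖u (x + k) - u x - u x * a x k‖ ≤ 3 * C₂ * ‖k‖ ^ 2 := by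
    intro k hk
    have hP := hu (h + k) hk
    have hQ := hu h hh
    have hdiff : ∀ t : ℝ, x₀ + t • (h + k) - (x₀ + t • h) = t • k := fun t ↦ by
      rw [smul_add]; abel
    have hnt : ∀ t ∈ Icc (0 : ℝ) 1, ‖t • k‖ ≤ ‖k‖ := fun t ht ↦ by
      rw [norm_smul, Real.norm_eq_abs, abs_of_nonneg ht.1]
      exact mul_le_of_le_one_left (norm_nonneg _) ht.2
    have hA1 : ∀ t ∈ Icc (0 : ℝ) 1, ∀ v,
        ‖a (x₀ + t • (h + k)) v - a (x₀ + t • h) v‖ ≤ K' * ‖k‖ * ‖v‖ := by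
      intro t ht v
      rw [← sub_apply]
      refine ContinuousLinearMap.le_of_opNorm_le _ ?_ v
      refine (ha1 _ (add_smul_mem_ball hh ht) _ (add_smul_mem_ball hk ht)).trans ?_
      rw [hdiff]
      gcongr
      exact hnt t ht
    have hA2 : ∀ t ∈ Icc (0 : ℝ) 1, ‖a (x₀ + t • (h + k)) h - a (x₀ + t • h) h -
        t • a' (x₀ + t • h) k h‖ ≤ |L| * ‖k‖ * ‖k‖ * r := by
      intro t ht
      have h1 := ha2 _ (add_smul_mem_ball hh ht) _ (add_smul_mem_ball hk ht)
      rw [hdiff] at h1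
      have h2 := ContinuousLinearMap.le_of_opNorm_le _ h1 h
      simp only [map_smul, sub_apply, smul_apply] at h2
      refine h2.trans ?_
      gcongr
      · exact hnt t ht
      · exact hnt t ht
    have hAK : ∀ t ∈ Icc (0 : ℝ) 1, ∀ v, ‖a (x₀ + t • h) v‖ ≤ K * ‖v‖ := fun t ht v ↦
      (a (x₀ + t • h)).le_of_opNorm_le (hK _ (add_smul_mem_ball hh ht)) v
    have hk0 := norm_nonneg k
    -- first order estimate
    have hD : ∀ t ∈ Icc (0 : ℝ) 1,
        ‖u (x₀ + t • (h + k)) - u (x₀ + t • h)‖ ≤ 3 * (C₁ * ‖k‖) := by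
      have := norm_le_of_norm_deriv_le (δ := 0) (ε := C₁ * ‖k‖)
        (fun t ht ↦ (hP t ht).sub (hQ t ht)) (by simp) (by positivity) (fun t ht ↦ ?_)
      · simpa using this
      · simp only [Pi.sub_apply]
        set P := u (x₀ + t • (h + k))
        set Q := u (x₀ + t • h)
        have e : P * a (x₀ + t • (h + k)) (h + k) - Q * a (x₀ + t • h) h =
            P * (a (x₀ + t • (h + k)) (h + k) - a (x₀ + t • h) (h + k)) + P * a (x₀ + t • h) k
            + (P - Q) * a (x₀ + t • h) h := by
          simp only [map_add]; noncomm_ring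
        have n1 : ‖P * (a (x₀ + t • (h + k)) (h + k) - a (x₀ + t • h) (h + k))‖
            ≤ C * (K' * ‖k‖ * r) := by
          refine norm_mul_le_of_le (hC _ hk t ht) ((hA1 t ht _).trans ?_)
          gcongr
        have n2 : ‖P * a (x₀ + t • h) k‖ ≤ C * (K * ‖k‖) :=
          norm_mul_le_of_le (hC _ hk t ht) (hAK t ht _)
        have n3 : ‖(P - Q) * a (x₀ + t • h) h‖ ≤ ‖P - Q‖ * (1 / 2) :=
          norm_mul_le_of_le le_rfl (norm_apply_le_half hK hKr hh ht)
        rw [e]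
        refine (norm_add₃_le).trans ?_
        have := norm_nonneg (P - Q)
        rw [hC₁]
        nlinarith
    -- second order estimate
    have hS : ∀ t ∈ Icc (0 : ℝ) 1, HasDerivWithinAt
        (fun t : ℝ ↦ u (x₀ + t • h) * (t • a (x₀ + t • h) k))
        (u (x₀ + t • h) * a (x₀ + t • h) h * (t • a (x₀ + t • h) k) +
          u (x₀ + t • h) * (t • a' (x₀ + t • h) h k + a (x₀ + t • h) k)) (Icc 0 1) t := by
      intro t ht
      have h1 : HasDerivAt (fun t : ℝ ↦ x₀ + t • h) h t := by
        simpa using ((hasDerivAt_id t).smul_const h).const_add x₀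
      have h2 : HasDerivAt (fun t : ℝ ↦ a (x₀ + t • h)) (a' (x₀ + t • h) h) t :=
        (ha _ (add_smul_mem_ball hh ht)).comp_hasDerivAt t h1
      have h3 : HasDerivAt (fun t : ℝ ↦ a (x₀ + t • h) k) (a' (x₀ + t • h) h k) t := by
        simpa using h2.clm_apply (hasDerivAt_const t k)
      have h4 := (hasDerivAt_id t).smul h3
      simp only [id, one_smul] at h4
      exact (hQ t ht).mul h4.hasDerivWithinAt
    have hfin := norm_le_of_norm_deriv_le (δ := 0) (ε := C₂ * ‖k‖ ^ 2)
        (fun t ht ↦ ((hP t ht).sub (hQ t ht)).sub (hS t ht)) (by simp) (by positivity)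
        (fun t ht ↦ ?_) 1 (by simp)
    · simp only [Pi.sub_apply, one_smul, zero_add, ← add_assoc, ← hxh] at hfin
      linarith
    · simp only [Pi.sub_apply]
      have hDt := hD t ht
      have hA1k := hA1 t ht k
      have hA2k := hA2 t ht
      have hAKk := hAK t ht k
      have hi := hint _ (add_smul_mem_ball hh ht) h k
      have hhalf := norm_apply_le_half hK hKr hh ht
      have hPC := hC _ hk t ht
      set P := u (x₀ + t • (h + k))
      set Q := u (x₀ + t • h)
      set A := a (x₀ + t • h)
      set A₁ := a (x₀ + t • (h + k))
      -- The only use of integrability: it exchanges the derivative of the coefficients along the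
      -- ray for the one across it, which is what comparing the two rays produces.
      have hi' : a' (x₀ + t • h) h k =
        a' (x₀ + t • h) k h + A k * A h - A h * A k := by rw [← hi]; abel
      -- The first four terms are O(‖k‖²); the last is the quantity being estimated times `A h`,
      -- which Grönwall absorbs. At t = 1 that quantity is the error of the claimed derivative.
      have e : P * A₁ (h + k) - Q * A h -
          (Q * A h * (t • A k) + Q * (t • a' (x₀ + t • h) h k + A k)) =
          P * (A₁ h - A h - t • a' (x₀ + t • h) k h) + (P - Q) * (t • a' (x₀ + t • h) k h)
          + P * (A₁ k - A k) + (P - Q) * A k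
          + (P - Q - Q * (t • A k)) * A h := by
        rw [hi']
        simp only [map_add, mul_add, smul_add, smul_sub, mul_sub, sub_mul, mul_smul_comm,
          smul_mul_assoc, mul_assoc]
        abel
      have hak : ‖t • a' (x₀ + t • h) k h‖ ≤ K' * ‖k‖ * r := by
        rw [norm_smul, Real.norm_eq_abs, abs_of_nonneg ht.1]
        have := (a' (x₀ + t • h)).le_of_opNorm_le (hK' _ (add_smul_mem_ball hh ht)) k
        have := ContinuousLinearMap.le_of_opNorm_le _ this h
        refine (mul_le_of_le_one_left (norm_nonneg _) ht.2).trans (this.trans ?_)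
        gcongr
      have n1 := norm_mul_le_of_le hPC hA2k
      have n2 := norm_mul_le_of_le hDt hak
      have n3 := norm_mul_le_of_le hPC hA1k
      have n4 := norm_mul_le_of_le hDt hAKk
      have n5 := norm_mul_le_of_le (le_refl ‖P - Q - Q * (t • A k)‖) hhalf
      rw [e]
      refine (norm_add_le _ _).trans ?_
      have n1234 := norm_add₃_le (a := P * (A₁ h - A h - t • a' (x₀ + t • h) k h))
        (b := (P - Q) * (t • a' (x₀ + t • h) k h)) (c := P * (A₁ k - A k))
      have n4' := norm_add_le (P * (A₁ h - A h - t • a' (x₀ + t • h) k h)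
        + (P - Q) * (t • a' (x₀ + t • h) k h) + P * (A₁ k - A k)) ((P - Q) * A k)
      have := norm_nonneg (P - Q - Q * (t • A k))
      rw [hC₂]
      nlinarith
  rw [hasFDerivAt_iff_isLittleO_nhds_zero]
  have hO : (fun k ↦ u (x + k) - u x - ((ContinuousLinearMap.mul ℝ R (u x)).comp (a x)) k)
      =O[𝓝 0] fun k : E ↦ ‖k‖ ^ 2 := by
    refine Asymptotics.IsBigO.of_bound (3 * C₂) ?_
    have hcont : Continuous fun k : E ↦ ‖h + k‖ := by fun_prop
    have : ∀ᶠ k in 𝓝 (0 : E), ‖h + k‖ < r :=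
      hcont.continuousAt.eventually_lt continuousAt_const (by simpa using hh)
    filter_upwards [this] with k hk
    simpa using hquad k hk
  exact hO.trans_isLittleO (Asymptotics.isLittleO_norm_pow_id one_lt_two)

end Pfaffian

/-! ### Coordinates that annihilate given Christoffel symbols -/

section Integration

set_option maxSynthPendingDepth 3

/-- Bootstrapping: if u is Cᵏ then so is du = u·a, and u is Cᵏ⁺¹. -/
theorem contDiffOn_of_hasFDerivAt_mul {E R : Type*} [NormedAddCommGroup E] [NormedSpace ℝ E]
    [NormedRing R] [NormedAlgebra ℝ R] {a : E → E →L[ℝ] R} {u : E → R} {s : Set E}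
    (hs : IsOpen s) (ha : ContDiffOn ℝ ∞ a s)
    (hu : ∀ x ∈ s, HasFDerivAt u ((ContinuousLinearMap.mul ℝ R (u x)).comp (a x)) x) :
    ContDiffOn ℝ ∞ u s := by
  rw [contDiffOn_infty]
  intro k
  induction k with
  | zero =>
    exact contDiffOn_zero.2 fun x hx ↦ (hu x hx).continuousAt.continuousWithinAt
  | succ k ih =>
    rw [Nat.cast_add, Nat.cast_one, contDiffOn_succ_iff_fderiv_of_isOpen hs]
    refine ⟨fun x hx ↦ (hu x hx).differentiableAt.differentiableWithinAt, by simp, ?_⟩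
    refine ContDiffOn.congr ?_ (fun x hx ↦ (hu x hx).fderiv)
    exact ((ContinuousLinearMap.mul ℝ R).contDiff.comp_contDiffOn ih).clm_comp
      (ha.of_le (by exact_mod_cast le_top))

variable {E : Type*} [NormedAddCommGroup E] [NormedSpace ℝ E] [CompleteSpace E]

/-- Near any point where it is symmetric and has vanishing curvature, a smooth family `G` of
Christoffel symbols is the pullback of the zero family by a local diffeomorphism. -/
theorem exists_contDiffOn_fderiv_fderiv_eq {G : E → E →L[ℝ] E →L[ℝ] E} {U : Set E} (hU : IsOpen U)
    (hG : ContDiffOn ℝ ∞ G U) (hsymm : ∀ x ∈ U, ∀ v w, G x v w = G x w v)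
    (hcurv : ∀ x ∈ U, ∀ v w,
      fderiv ℝ G x v w + G x v * G x w = fderiv ℝ G x w v + G x w * G x v)
    {x₀ : E} (hx₀ : x₀ ∈ U) :
    ∃ φ : OpenPartialHomeomorph E E, x₀ ∈ φ.source ∧ φ.source ⊆ U ∧
      ContDiffOn ℝ ∞ φ φ.source ∧ ContDiffOn ℝ ∞ φ.symm φ.target ∧
      ∀ x ∈ φ.source, ∀ v w, fderiv ℝ (fderiv ℝ φ) x v w = fderiv ℝ φ x (G x v w) := by
  have hG₀ : ContDiffAt ℝ ∞ G x₀ := hG.contDiffAt (hU.mem_nhds hx₀)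
  have hG₁ : ContDiffAt ℝ 1 (fderiv ℝ G) x₀ :=
    hG₀.fderiv_right (m := 1) (by norm_cast)
  obtain ⟨L, t, ht, hL⟩ := hG₁.exists_lipschitzOnWith
  have hK : ∀ᶠ x in 𝓝 x₀, ‖G x‖ < ‖G x₀‖ + 1 :=
    hG₀.continuousAt.norm.eventually_lt continuousAt_const (by simp)
  have hK' : ∀ᶠ x in 𝓝 x₀, ‖fderiv ℝ G x‖ < ‖fderiv ℝ G x₀‖ + 1 :=
    hG₁.continuousAt.norm.eventually_lt continuousAt_const (by simp)
  obtain ⟨ρ, hρ, hρ'⟩ := Metric.eventually_nhds_iff_ball.1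
    ((hK.and hK').and ((hU.eventually_mem hx₀).and
      (Filter.eventually_mem_set.2 ht)))
  set K := ‖G x₀‖ + 1 with hKdef
  have hKpos : 0 < K := by positivity
  -- The second bound gives K * r ≤ 1/2, the smallness that the radial equation needs.
  set r := min ρ (1 / (2 * K)) with hr_def
  have hr : 0 < r := lt_min hρ (by positivity)
  have hsub : ball x₀ r ⊆ ball x₀ ρ := ball_subset_ball (min_le_left _ _)
  have hBU : ball x₀ r ⊆ U := fun x hx ↦ (hρ' x (hsub hx)).2.1
  have hKr : K * r ≤ 1 / 2 := by
    calc K * r ≤ K * (1 / (2 * K)) := by gcongr; exact min_le_right _ _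
      _ = 1 / 2 := by field_simp
  have hGB : ContDiffOn ℝ ∞ G (ball x₀ r) := hG.mono hBU
  obtain ⟨θ, hθ0, hθ⟩ := exists_hasFDerivAt_of_integrable (a := G) (a' := fderiv ℝ G) (L := L) hr
    (fun x hx ↦ ((hG.contDiffAt (hU.mem_nhds (hBU hx))).differentiableAt (by simp)).hasFDerivAt)
    (fun x hx ↦ (hρ' x (hsub hx)).1.1.le) (fun x hx ↦ (hρ' x (hsub hx)).1.2.le)
    (fun x hx y hy ↦ by
      have := hL.dist_le_mul x (hρ' x (hsub hx)).2.2 y (hρ' y (hsub hy)).2.2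
      rwa [dist_eq_norm, dist_eq_norm] at this)
    hKr (fun x hx ↦ hcurv x (hBU hx)) (1 : E →L[ℝ] E)
  have hθs : ContDiffOn ℝ ∞ θ (ball x₀ r) := contDiffOn_of_hasFDerivAt_mul isOpen_ball hGB hθ
  -- Since dθ(v)w = θ(G(v)w) is symmetric in v and w, the form θ is closed, and the Poincaré lemma
  -- on the ball gives θ = Df.
  obtain ⟨f, hf⟩ := (convex_ball x₀ r).exists_forall_hasFDerivAt_of_fderiv_symmetric isOpen_ball
    (hθs.differentiableOn (by simp)) (fun x hx v w ↦ by
      rw [(hθ x hx).fderiv]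
      simp [hsymm x (hBU hx) v w])
  have hfs : ContDiffOn ℝ ∞ f (ball x₀ r) := by
    rw [show (∞ : ℕ∞ω) = ∞ + 1 from rfl, contDiffOn_succ_iff_fderiv_of_isOpen isOpen_ball]
    exact ⟨fun x hx ↦ (hf x hx).differentiableAt.differentiableWithinAt, by simp,
      hθs.congr fun x hx ↦ (hf x hx).fderiv⟩
  have hx₀r : x₀ ∈ ball x₀ r := mem_ball_self hr
  have hfa : ContDiffAt ℝ ∞ f x₀ := hfs.contDiffAt (isOpen_ball.mem_nhds hx₀r)
  have hfd : HasFDerivAt f ((ContinuousLinearEquiv.refl ℝ E : E ≃L[ℝ] E) : E →L[ℝ] E) x₀ := by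
    have := hf x₀ hx₀r
    rwa [hθ0] at this
  let ψ := hfa.toOpenPartialHomeomorph f hfd (by simp)
  have hψ : (ψ : E → E) = f := rfl
  -- Smoothness of the inverse on the whole target needs Df = θ invertible on the whole source, not
  -- just at x₀ where θ = 1.
  have hinv : IsOpen (ball x₀ r ∩ {x | IsUnit (θ x)}) :=
    hθs.continuousOn.isOpen_inter_preimage isOpen_ball Units.isOpen
  let φ := ψ.restrOpen _ hinv
  have hφ : (φ : E → E) = f := rfl
  have hsrc : φ.source ⊆ ball x₀ r ∩ {x | IsUnit (θ x)} := by
    intro x hx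
    exact hx.2
  refine ⟨φ, ⟨hfa.mem_toOpenPartialHomeomorph_source hfd (by simp), hx₀r, ?_⟩,
    fun x hx ↦ hBU (hsrc hx).1, ?_, ?_, ?_⟩
  · simp [hθ0]
  · rw [hφ]; exact hfs.mono fun x hx ↦ (hsrc hx).1
  · intro y hy
    have hx := hsrc (φ.map_target hy)
    obtain ⟨T, hT⟩ := hx.2
    refine (φ.contDiffAt_symm hy (f₀' := ContinuousLinearEquiv.unitsEquiv ℝ E T)
      ?_ ?_).contDiffWithinAt
    · have := hf _ hx.1
      rw [hφ]
      convert this using 1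
      exact hT
    · rw [hφ]; exact hfs.contDiffAt (isOpen_ball.mem_nhds hx.1)
  · intro x hx v w
    have hxb := (hsrc hx).1
    rw [hφ, (hf x hxb).fderiv]
    have : fderiv ℝ f =ᶠ[𝓝 x] θ := by
      filter_upwards [isOpen_ball.mem_nhds hxb] with y hy using (hf y hy).fderiv
    rw [this.fderiv_eq, (hθ x hxb).fderiv]
    rfl

end Integration

/-! ### Vector fields and the flat connection in one chart -/

section Charts

variable {E : Type*} [NormedAddCommGroup E] [NormedSpace ℝ E]
  {M : Type*} [TopologicalSpace M] [ChartedSpace E M]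

/-- The derivative of a chart at a point, with values in the model space. -/
noncomputable def chartDeriv (e : OpenPartialHomeomorph M E) (x : M) :
    TangentSpace 𝓘(ℝ, E) x →L[ℝ] E :=
  mfderiv 𝓘(ℝ, E) 𝓘(ℝ, E) e x

/-- The inverse of the derivative of a chart at a point of its domain. -/
noncomputable def chartDerivInv (e : OpenPartialHomeomorph M E) (x : M) :
    E →L[ℝ] TangentSpace 𝓘(ℝ, E) x :=
  (chartDeriv e x).inverse

/-- The principal part of a vector field in a chart. -/
noncomputable def rep (e : OpenPartialHomeomorph M E) (Y : Π x : M, TangentSpace 𝓘(ℝ, E) x) :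
    E → E :=
  fun u ↦ chartDeriv e (e.symm u) (Y (e.symm u))

/-- The vector field on the domain of a chart with a given principal part. -/
noncomputable def lift (e : OpenPartialHomeomorph M E) (f : E → E) (x : M) :
    TangentSpace 𝓘(ℝ, E) x :=
  chartDerivInv e x (f (e x))

/-- The flat connection of a chart: differentiation of principal parts. -/
noncomputable def flatCov (e : OpenPartialHomeomorph M E)
    (Y : Π x : M, TangentSpace 𝓘(ℝ, E) x) (x : M) :
    TangentSpace 𝓘(ℝ, E) x →L[ℝ] TangentSpace 𝓘(ℝ, E) x :=
  (chartDerivInv e x).comp ((fderiv ℝ (rep e Y) (e x)).comp (chartDeriv e x))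

variable {e e' : OpenPartialHomeomorph M E} {X Y : Π x : M, TangentSpace 𝓘(ℝ, E) x} {x : M}

theorem rep_add : rep e (X + Y) = rep e X + rep e Y := by
  ext u; simp [rep]

theorem rep_smul (g : M → ℝ) : rep e (g • Y) = (g ∘ e.symm) • rep e Y := by
  ext u; simp [rep]

theorem rep_apply_chart (hx : x ∈ e.source) : rep e Y (e x) = chartDeriv e x (Y x) := by
  simp only [rep]
  rw [e.left_inv hx]

theorem mdifferentiable_of_mem_maximalAtlas
    (he : e ∈ IsManifold.maximalAtlas 𝓘(ℝ, E) ∞ M) : e.MDifferentiable 𝓘(ℝ, E) 𝓘(ℝ, E) :=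
  ⟨(contMDiffOn_of_mem_maximalAtlas he).mdifferentiableOn (by simp),
    (contMDiffOn_symm_of_mem_maximalAtlas he).mdifferentiableOn (by simp)⟩

section

variable (he : e ∈ IsManifold.maximalAtlas 𝓘(ℝ, E) ∞ M) (hx : x ∈ e.source)
include he hx

theorem isInvertible_mfderiv_chart :
    (mfderiv 𝓘(ℝ, E) 𝓘(ℝ, E) e x).IsInvertible :=
  ⟨(mdifferentiable_of_mem_maximalAtlas he).mfderiv hx, rfl⟩

theorem isInvertible_chartDeriv : (chartDeriv e x).IsInvertible :=
  isInvertible_mfderiv_chart he hx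

@[simp]
theorem chartDeriv_chartDerivInv (v : E) : chartDeriv e x (chartDerivInv e x v) = v :=
  (isInvertible_chartDeriv he hx).self_apply_inverse v

@[simp]
theorem chartDerivInv_chartDeriv (v : TangentSpace 𝓘(ℝ, E) x) :
    chartDerivInv e x (chartDeriv e x v) = v :=
  (isInvertible_chartDeriv he hx).inverse_apply_self v

theorem chartDeriv_injective : Function.Injective (chartDeriv e x) :=
  Function.LeftInverse.injective (chartDerivInv_chartDeriv he hx)

theorem lift_rep_apply : lift e (rep e Y) x = Y x := by
  rw [lift, rep_apply_chart hx, chartDerivInv_chartDeriv he hx]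

theorem isInvertible_mfderiv_chart_symm :
    (mfderiv 𝓘(ℝ, E) 𝓘(ℝ, E) e.symm (e x)).IsInvertible :=
  ⟨(mdifferentiable_of_mem_maximalAtlas he).symm.mfderiv (e.map_source hx), rfl⟩

/-- Gives access to the regularity theorems for pullbacks of vector fields. -/
theorem rep_eq_mpullback :
    rep e Y (e x) = mpullback 𝓘(ℝ, E) 𝓘(ℝ, E) e.symm Y (e x) := by
  rw [mpullback_apply, rep]
  refine ((isInvertible_mfderiv_chart_symm he hx).inverse_apply_eq.2 ?_).symm
  have h := (mdifferentiable_of_mem_maximalAtlas he).symm_comp_deriv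
    (e.map_target (e.map_source hx))
  rw [e.right_inv (e.map_source hx)] at h
  exact (DFunLike.congr_fun h _).symm

theorem rep_eventuallyEq_mpullback :
    rep e Y =ᶠ[𝓝 (e x)] mpullback 𝓘(ℝ, E) 𝓘(ℝ, E) e.symm Y := by
  filter_upwards [e.open_target.mem_nhds (e.map_source hx)] with u hu
  have := rep_eq_mpullback (Y := Y) he (e.map_target hu)
  rwa [e.right_inv hu] at this

theorem chartDeriv_flatCov (v : TangentSpace 𝓘(ℝ, E) x) :
    chartDeriv e x (flatCov e Y x v) = fderiv ℝ (rep e Y) (e x) (chartDeriv e x v) :=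
  chartDeriv_chartDerivInv he hx _

variable [IsManifold 𝓘(ℝ, E) ∞ M]

theorem contDiffAt_rep {k : ℕ∞ω} (hk : k ≤ ∞)
    (hY : ContMDiffAt 𝓘(ℝ, E) 𝓘(ℝ, E).tangent k (fun x ↦ (⟨x, Y x⟩ : TangentBundle 𝓘(ℝ, E) M)) x)
    [CompleteSpace E] :
    ContDiffAt ℝ k (rep e Y) (e x) := by
  refine ContDiffAt.congr_of_eventuallyEq ?_ (rep_eventuallyEq_mpullback he hx)
  rw [← contMDiffAt_vectorSpace_iff_contDiffAt]
  refine ContMDiffAt.mpullback_vectorField_preimage (n := ∞) ?_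
    (contMDiffAt_symm_of_mem_maximalAtlas he (e.map_source hx))
    (isInvertible_mfderiv_chart_symm he hx) ?_
  · rwa [e.left_inv hx]
  · exact (add_le_add_left hk 1).trans (by simp)

theorem differentiableAt_rep
    (hY : MDifferentiableAt 𝓘(ℝ, E) 𝓘(ℝ, E).tangent
      (fun x ↦ (⟨x, Y x⟩ : TangentBundle 𝓘(ℝ, E) M)) x) [CompleteSpace E] :
    DifferentiableAt ℝ (rep e Y) (e x) := by
  refine DifferentiableAt.congr_of_eventuallyEq ?_ (rep_eventuallyEq_mpullback he hx)
  apply MDifferentiableAt.differentiableAt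
  have : MDifferentiableAt 𝓘(ℝ, E) 𝓘(ℝ, E).tangent (fun u ↦
      (⟨u, mpullback 𝓘(ℝ, E) 𝓘(ℝ, E) e.symm Y u⟩ : TangentBundle 𝓘(ℝ, E) E)) (e x) := by
    refine MDifferentiableAt.mpullback_vectorField (n := ∞) ?_
      (contMDiffAt_symm_of_mem_maximalAtlas he (e.map_source hx))
      (isInvertible_mfderiv_chart_symm he hx) (by norm_cast)
    rwa [e.left_inv hx]
  exact ((contMDiff_snd_tangentBundle_modelSpace E 𝓘(ℝ, E)).contMDiffAt.mdifferentiableAt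
    one_ne_zero).comp _ this

theorem contMDiffAt_lift [CompleteSpace E] {k : ℕ∞ω} (hk : k ≤ ∞) {f : E → E}
    (hf : ContDiffAt ℝ k f (e x)) :
    ContMDiffAt 𝓘(ℝ, E) 𝓘(ℝ, E).tangent k
      (fun x ↦ (⟨x, lift e f x⟩ : TangentBundle 𝓘(ℝ, E) M)) x := by
  refine ContMDiffAt.mpullback_vectorField_preimage (n := ∞)
    (contMDiffAt_vectorSpace_iff_contDiffAt.2 hf)
    (contMDiffAt_of_mem_maximalAtlas he hx) (isInvertible_mfderiv_chart he hx) ?_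
  exact (add_le_add_left hk 1).trans (by simp)

/-- Near x each field is the pullback of its principal part, and the bracket commutes with pullback.
-/
theorem chartDeriv_mlieBracket [CompleteSpace E]
    (hX : MDifferentiableAt 𝓘(ℝ, E) 𝓘(ℝ, E).tangent
      (fun x ↦ (⟨x, X x⟩ : TangentBundle 𝓘(ℝ, E) M)) x)
    (hY : MDifferentiableAt 𝓘(ℝ, E) 𝓘(ℝ, E).tangent
      (fun x ↦ (⟨x, Y x⟩ : TangentBundle 𝓘(ℝ, E) M)) x) :
    chartDeriv e x (mlieBracket 𝓘(ℝ, E) X Y x) =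
      fderiv ℝ (rep e Y) (e x) (rep e X (e x)) - fderiv ℝ (rep e X) (e x) (rep e Y (e x)) := by
  have hloc : ∀ Z : Π x : M, TangentSpace 𝓘(ℝ, E) x,
      Z =ᶠ[𝓝 x] mpullback 𝓘(ℝ, E) 𝓘(ℝ, E) e (rep e Z) := fun Z ↦ by
    filter_upwards [e.open_source.mem_nhds hx] with y hy
    exact (lift_rep_apply he hy).symm
  have hmd : ∀ Z : Π u : E, TangentSpace 𝓘(ℝ, E) u, DifferentiableAt ℝ Z (e x) →
      MDifferentiableAt 𝓘(ℝ, E) 𝓘(ℝ, E).tangent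
        (fun u ↦ (⟨u, Z u⟩ : TangentBundle 𝓘(ℝ, E) E)) (e x) := fun Z hZ ↦ by
    rw [mdifferentiableAt_section]
    simpa using hZ.mdifferentiableAt
  have : IsManifold 𝓘(ℝ, E) (minSmoothness ℝ 2) M := by
    rw [minSmoothness_of_isRCLikeNormedField]; infer_instance
  rw [(hloc X).mlieBracket_vectorField_eq (hloc Y),
    ← mpullback_mlieBracket (n := ∞) (hmd _ (differentiableAt_rep he hx hX))
      (hmd _ (differentiableAt_rep he hx hY)) (contMDiffAt_of_mem_maximalAtlas he hx)
      (by rw [minSmoothness_of_isRCLikeNormedField]; norm_cast)]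
  have hlie : ∀ V W : Π u : E, TangentSpace 𝓘(ℝ, E) u,
      mlieBracket 𝓘(ℝ, E) V W (e x) = lieBracket ℝ V W (e x) := fun V W ↦ by
    rw [← mlieBracketWithin_univ, mlieBracketWithin_eq_lieBracketWithin]
    exact congrFun (lieBracketWithin_univ (E := E) (V := V) (W := W)) _
  exact (chartDeriv_chartDerivInv he hx _).trans (hlie (rep e X) (rep e Y))

end

variable [IsManifold 𝓘(ℝ, E) ∞ M]

theorem isCovariantDerivativeOn_flatCov [CompleteSpace E]
    (he : e ∈ IsManifold.maximalAtlas 𝓘(ℝ, E) ∞ M) :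
    IsCovariantDerivativeOn E (flatCov e : (Π x : M, TangentSpace 𝓘(ℝ, E) x) →
      (Π x : M, TangentSpace 𝓘(ℝ, E) x →L[ℝ] TangentSpace 𝓘(ℝ, E) x)) e.source where
  add {σ σ' x} hσ hσ' hx := by
    ext1 v
    apply chartDeriv_injective he hx
    rw [add_apply, map_add, chartDeriv_flatCov he hx, chartDeriv_flatCov he hx,
      chartDeriv_flatCov he hx, rep_add,
      fderiv_add (differentiableAt_rep he hx hσ) (differentiableAt_rep he hx hσ')]
    rfl
  leibniz {σ g x} hσ hg hx := by
    ext1 v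
    apply chartDeriv_injective he hx
    have hg' : DifferentiableAt ℝ (g ∘ e.symm) (e x) := by
      apply MDifferentiableAt.differentiableAt
      refine MDifferentiableAt.comp (I' := 𝓘(ℝ, E)) _ ?_
        ((mdifferentiable_of_mem_maximalAtlas he).mdifferentiableAt_symm (e.map_source hx))
      rwa [e.left_inv hx]
    have hd : fderiv ℝ (g ∘ e.symm) (e x) (chartDeriv e x v) = mfderiv 𝓘(ℝ, E) 𝓘(ℝ, ℝ) g x v := by
      have hge : g =ᶠ[𝓝 x] (g ∘ e.symm) ∘ e := by
        filter_upwards [e.open_source.mem_nhds hx] with y hy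
        simp [e.left_inv hy]
      rw [hge.mfderiv_eq, mfderiv_comp (I' := 𝓘(ℝ, E)) x hg'.mdifferentiableAt
        ((mdifferentiable_of_mem_maximalAtlas he).mdifferentiableAt hx), mfderiv_eq_fderiv]
      rfl
    rw [chartDeriv_flatCov he hx, rep_smul, fderiv_smul hg' (differentiableAt_rep he hx hσ)]
    simp only [Function.comp_apply, e.left_inv hx, add_apply, smul_apply,
      ContinuousLinearMap.smulRight_apply, map_add, map_smul, chartDeriv_flatCov he hx, hd,
      rep_apply_chart hx]
    rfl

end Charts

/-! ### Change of chart -/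

section Transition

variable {E : Type*} [NormedAddCommGroup E] [NormedSpace ℝ E]
  {M : Type*} [TopologicalSpace M] [ChartedSpace E M]
  {e e' : OpenPartialHomeomorph M E} {X Y : Π x : M, TangentSpace 𝓘(ℝ, E) x} {x : M}
  (he : e ∈ IsManifold.maximalAtlas 𝓘(ℝ, E) ∞ M) (he' : e' ∈ IsManifold.maximalAtlas 𝓘(ℝ, E) ∞ M)
  (hx : x ∈ e.source) (hx' : x ∈ e'.source)
include he he' hx hx'

theorem contDiffAt_transition : ContDiffAt ℝ ∞ (e' ∘ e.symm) (e x) := by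
  rw [← contMDiffAt_iff_contDiffAt]
  refine ContMDiffAt.comp (I' := 𝓘(ℝ, E)) _ ?_
    (contMDiffAt_symm_of_mem_maximalAtlas he (e.map_source hx))
  rw [e.left_inv hx]
  exact contMDiffAt_of_mem_maximalAtlas he' hx'

theorem chartDeriv_eq_fderiv_comp :
    chartDeriv e' x = (fderiv ℝ (e' ∘ e.symm) (e x)).comp (chartDeriv e x) := by
  have h : e' =ᶠ[𝓝 x] (e' ∘ e.symm) ∘ e := by
    filter_upwards [e.open_source.mem_nhds hx] with y hy
    simp [e.left_inv hy]
  rw [chartDeriv, h.mfderiv_eq, mfderiv_comp (I' := 𝓘(ℝ, E)) x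
    ((contDiffAt_transition he he' hx hx').differentiableAt (by simp)).mdifferentiableAt
    ((mdifferentiable_of_mem_maximalAtlas he).mdifferentiableAt hx), mfderiv_eq_fderiv]
  rfl

theorem chartDeriv_comp_chartDerivInv :
    (chartDeriv e' x).comp (chartDerivInv e x) = fderiv ℝ (e' ∘ e.symm) (e x) := by
  rw [chartDeriv_eq_fderiv_comp he he' hx hx']
  ext v
  simp [chartDeriv_chartDerivInv he hx]

omit hx hx' in
theorem fderiv_transition_bijective (hx : x ∈ e.source) (hx' : x ∈ e'.source) :
    Function.Bijective (fderiv ℝ (e' ∘ e.symm) (e x)) := by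
  rw [← chartDeriv_comp_chartDerivInv he he' hx hx']
  have h1 : Function.Bijective (chartDeriv e' x) :=
    (isInvertible_chartDeriv he' hx').bijective
  have h2 : Function.Bijective (chartDerivInv e x) :=
    (isInvertible_chartDeriv he hx).inverse.bijective
  exact h1.comp h2

theorem rep_transition_eventuallyEq :
    (fun u ↦ rep e' Y ((e' ∘ e.symm) u)) =ᶠ[𝓝 (e x)]
      fun u ↦ fderiv ℝ (e' ∘ e.symm) u (rep e Y u) := by
  have h1 : ∀ᶠ u in 𝓝 (e x), u ∈ e.target := e.open_target.mem_nhds (e.map_source hx)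
  have h2 : ∀ᶠ u in 𝓝 (e x), e.symm u ∈ e'.source :=
    (e.continuousAt_symm (e.map_source hx)).eventually_mem
      (by rw [e.left_inv hx]; exact e'.open_source.mem_nhds hx')
  filter_upwards [h1, h2] with u hu hu'
  have h := chartDeriv_eq_fderiv_comp he he' (e.map_target hu) hu'
  rw [e.right_inv hu] at h
  rw [Function.comp_apply, rep_apply_chart hu', h]
  rfl

variable [IsManifold 𝓘(ℝ, E) ∞ M] [CompleteSpace E]

/-- The difference of the flat connections of two charts is given by the second derivative of the
change of coordinates. -/
theorem chartDeriv_flatCov_transition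
    (hY : MDifferentiableAt 𝓘(ℝ, E) 𝓘(ℝ, E).tangent
      (fun x ↦ (⟨x, Y x⟩ : TangentBundle 𝓘(ℝ, E) M)) x) (v : TangentSpace 𝓘(ℝ, E) x) :
    chartDeriv e' x (flatCov e' Y x v) = chartDeriv e' x (flatCov e Y x v) +
      fderiv ℝ (fderiv ℝ (e' ∘ e.symm)) (e x) (chartDeriv e x v) (chartDeriv e x (Y x)) := by
  have hτ := contDiffAt_transition he he' hx hx'
  have hτx : (e' ∘ e.symm) (e x) = e' x := by simp [e.left_inv hx]
  have h1 : HasFDerivAt (fun u ↦ rep e' Y ((e' ∘ e.symm) u))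
      ((fderiv ℝ (rep e' Y) (e' x)).comp (fderiv ℝ (e' ∘ e.symm) (e x))) (e x) := by
    have h0 : HasFDerivAt (rep e' Y) (fderiv ℝ (rep e' Y) (e' x)) ((e' ∘ e.symm) (e x)) := by
      rw [hτx]
      exact (differentiableAt_rep he' hx' hY).hasFDerivAt
    exact h0.comp (e x) (hτ.differentiableAt (by simp)).hasFDerivAt
  have hτ' : DifferentiableAt ℝ (fderiv ℝ (e' ∘ e.symm)) (e x) :=
    (hτ.fderiv_right (m := 1) (by norm_cast)).differentiableAt one_ne_zero
  have hrY : HasFDerivAt (rep e Y) (fderiv ℝ (rep e Y) (e x)) (e x) :=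
    (differentiableAt_rep he hx hY).hasFDerivAt
  have h2 := hτ'.hasFDerivAt.clm_apply hrY
  -- The law Y' ∘ τ = Dτ · Y for principal parts is differentiated on both sides; the product rule
  -- on the right creates the D²τ term.
  have h3 := h1.unique (h2.congr_of_eventuallyEq (rep_transition_eventuallyEq he he' hx hx'))
  have h4 := DFunLike.congr_fun h3 (chartDeriv e x v)
  rw [chartDeriv_flatCov he' hx', chartDeriv_eq_fderiv_comp he he' hx hx']
  simp only [ContinuousLinearMap.comp_apply, add_apply, ContinuousLinearMap.flip_apply] at h4 ⊢
  rw [h4, chartDeriv_flatCov he hx, rep_apply_chart hx]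

end Transition

/-! ### From an affine atlas to a connection -/

section Glue

variable {E : Type*} [NormedAddCommGroup E] [NormedSpace ℝ E] [CompleteSpace E]
  {M : Type*} [TopologicalSpace M] [ChartedSpace E M] [IsManifold 𝓘(ℝ, E) ∞ M]
  (c : M → OpenPartialHomeomorph M E)
  (hc : ∀ x, c x ∈ IsManifold.maximalAtlas 𝓘(ℝ, E) ∞ M) (hxc : ∀ x, x ∈ (c x).source)

/-- The connection which is at each point the flat connection of a chosen chart. -/
noncomputable def gluedCov : CovariantDerivative 𝓘(ℝ, E) E (TangentSpace 𝓘(ℝ, E) : M → Type _) where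
  -- The axioms of a covariant derivative are checked at one point at a time, so no compatibility of
  -- the charts is needed yet.
  toFun Y x := flatCov (c x) Y x
  isCovariantDerivativeOnUniv :=
    { add := fun {_ _ x} hσ hσ' _ ↦ (isCovariantDerivativeOn_flatCov (hc x)).add hσ hσ' (hxc x)
      leibniz := fun {_ _ x} hσ hg _ ↦
        (isCovariantDerivativeOn_flatCov (hc x)).leibniz hσ hg (hxc x) }

theorem gluedCov_apply (Y : Π x : M, TangentSpace 𝓘(ℝ, E) x) (x : M) :
    gluedCov c hc hxc Y x = flatCov (c x) Y x := rfl

theorem torsion_gluedCov [FiniteDimensional ℝ E] : (gluedCov c hc hxc).torsion = 0 := by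
  rw [CovariantDerivative.torsion_eq_zero_iff]
  intro X Y x hX hY
  apply chartDeriv_injective (hc x) (hxc x)
  rw [map_sub, gluedCov_apply, gluedCov_apply, chartDeriv_flatCov (hc x) (hxc x),
    chartDeriv_flatCov (hc x) (hxc x), chartDeriv_mlieBracket (hc x) (hxc x) hX hY,
    rep_apply_chart (hxc x), rep_apply_chart (hxc x)]

variable (hagree : ∀ x, ∀ y ∈ (c x).source, ∀ Y : Π x : M, TangentSpace 𝓘(ℝ, E) x,
  MDifferentiableAt 𝓘(ℝ, E) 𝓘(ℝ, E).tangent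
      (fun x ↦ (⟨x, Y x⟩ : TangentBundle 𝓘(ℝ, E) M)) y → flatCov (c y) Y y = flatCov (c x) Y y)
include hagree

/-- Curvature differentiates ∇Z, so a single chart has to compute ∇ near x; this is where agreement
of the flat connections enters. -/
theorem rep_gluedCov_eventuallyEq (x : M) {Y Z : Π x : M, TangentSpace 𝓘(ℝ, E) x}
    (hZ : MDifferentiable 𝓘(ℝ, E) 𝓘(ℝ, E).tangent
      (fun x ↦ (⟨x, Z x⟩ : TangentBundle 𝓘(ℝ, E) M))) :
    rep (c x) (fun y ↦ gluedCov c hc hxc Z y (Y y)) =ᶠ[𝓝 (c x x)]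
      fun u ↦ fderiv ℝ (rep (c x) Z) u (rep (c x) Y u) := by
  filter_upwards [(c x).open_target.mem_nhds ((c x).map_source (hxc x))] with u hu
  have hy := (c x).map_target hu
  rw [rep, gluedCov_apply, hagree x _ hy _ (hZ _), chartDeriv_flatCov (hc x) hy,
    (c x).right_inv hu]
  rfl

/-- Derivatives of X and Y cancel against the bracket; what remains is the antisymmetrization of the
second derivative of Z. -/
theorem isFlat_gluedCov : (gluedCov c hc hxc).IsFlat := by
  intro X Y Z hX hY hZ x
  apply chartDeriv_injective (hc x) (hxc x)
  have hX' := hX.mdifferentiable (by simp)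
  have hY' := hY.mdifferentiable (by simp)
  have hZ' := hZ.mdifferentiable (by simp)
  have hrX := differentiableAt_rep (hc x) (hxc x) (hX' x)
  have hrY := differentiableAt_rep (hc x) (hxc x) (hY' x)
  have hrZ := contDiffAt_rep (hc x) (hxc x) le_rfl (hZ x)
  have hrZ' : DifferentiableAt ℝ (fderiv ℝ (rep (c x) Z)) (c x x) :=
    (hrZ.fderiv_right (m := 1) (by norm_cast)).differentiableAt one_ne_zero
  have hsymm : IsSymmSndFDerivAt ℝ (rep (c x) Z) (c x x) :=
    hrZ.isSymmSndFDerivAt (by rw [minSmoothness_of_isRCLikeNormedField]; norm_cast)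
  rw [CovariantDerivative.curvatureAt, map_sub, map_sub, gluedCov_apply, gluedCov_apply,
    gluedCov_apply, chartDeriv_flatCov (hc x) (hxc x), chartDeriv_flatCov (hc x) (hxc x),
    chartDeriv_flatCov (hc x) (hxc x), chartDeriv_mlieBracket (hc x) (hxc x) (hX' x) (hY' x),
    (rep_gluedCov_eventuallyEq c hc hxc hagree x hZ').fderiv_eq,
    (rep_gluedCov_eventuallyEq c hc hxc hagree x hZ').fderiv_eq,
    (hrZ'.hasFDerivAt.clm_apply hrX.hasFDerivAt).fderiv,
    (hrZ'.hasFDerivAt.clm_apply hrY.hasFDerivAt).fderiv,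
    ← rep_apply_chart (hxc x), ← rep_apply_chart (hxc x)]
  simp only [ContinuousLinearMap.comp_apply, add_apply, ContinuousLinearMap.flip_apply, map_sub,
    map_zero]
  rw [hsymm (rep (c x) X (c x x)) (rep (c x) Y (c x x))]
  abel

theorem contMDiff_gluedCov : (gluedCov c hc hxc).ContMDiffCovariantDerivative ∞ := by
  refine ⟨⟨fun {Y} hY ↦ ?_⟩⟩
  rw [contMDiffOn_univ] at hY ⊢
  intro x₀
  have hY' := hY.mdifferentiable (by simp)
  rw [contMDiffAt_hom_bundle]
  refine ⟨contMDiffAt_id, ?_⟩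
  set e := c x₀
  have he := hc x₀
  have hxe : x₀ ∈ e.source := hxc x₀
  set d := chartAt E x₀ with hd_def
  have hd : d ∈ IsManifold.maximalAtlas 𝓘(ℝ, E) ∞ M := IsManifold.chart_mem_maximalAtlas x₀
  have hxd : x₀ ∈ d.source := mem_chart_source E x₀
  have hrY := contDiffAt_rep he hxe le_rfl (hY x₀)
  -- This is ∇Y in the trivialization at x₀: the derivative of the components in `e`, conjugated by
  -- the change between `e` and the preferred chart `d`. Agreement permits the fixed `e` although `c
  -- x` varies with x.
  have h1 : ContMDiffAt 𝓘(ℝ, E) 𝓘(ℝ, E →L[ℝ] E) ∞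
      (fun x ↦ (fderiv ℝ (d ∘ e.symm) (e x)).comp
        ((fderiv ℝ (rep e Y) (e x)).comp (fderiv ℝ (e ∘ d.symm) (d x)))) x₀ := by
    have k1 := ((contDiffAt_transition he hd hxe hxd).fderiv_right (m := ∞)
      le_rfl).contMDiffAt.comp x₀ (contMDiffAt_of_mem_maximalAtlas he hxe)
    have k2 := (hrY.fderiv_right (m := ∞) le_rfl).contMDiffAt.comp x₀
      (contMDiffAt_of_mem_maximalAtlas he hxe)
    have k3 := ((contDiffAt_transition hd he hxd hxe).fderiv_right (m := ∞)
      le_rfl).contMDiffAt.comp x₀ (contMDiffAt_of_mem_maximalAtlas hd hxd)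
    exact k1.clm_comp (k2.clm_comp k3)
  refine h1.congr_of_eventuallyEq ?_
  filter_upwards [e.open_source.mem_nhds hxe, d.open_source.mem_nhds hxd] with x hx hx'
  have k1 := TangentBundle.continuousLinearMapAt_trivializationAt (I := 𝓘(ℝ, E)) (x₀ := x₀) hx'
  have k1' : (trivializationAt E (TangentSpace 𝓘(ℝ, E)) x₀).continuousLinearMapAt ℝ x =
      chartDeriv d x := by
    rw [k1]; rfl
  have k2' : (trivializationAt E (TangentSpace 𝓘(ℝ, E)) x₀).symmL ℝ x =
      chartDerivInv d x := by
    ext1 v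
    apply chartDeriv_injective hd hx'
    rw [chartDeriv_chartDerivInv hd hx', ← k1']
    exact Bundle.Trivialization.continuousLinearMapAt_symmL _ (by simpa using hx') v
  have k3 : gluedCov c hc hxc Y x = flatCov e Y x := hagree x₀ x hx Y (hY' x)
  simp only [ContinuousLinearMap.inCoordinates]
  erw [k1', k2']
  rw [k3, flatCov, ← chartDeriv_comp_chartDerivInv he hd hx hx',
    ← chartDeriv_comp_chartDerivInv hd he hx' hx]
  rfl

end Glue

/-! ### From a flat torsion-free connection to flat charts -/

section FlatCharts

variable {E : Type*} [NormedAddCommGroup E] [NormedSpace ℝ E] [FiniteDimensional ℝ E]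
  {M : Type*} [TopologicalSpace M] [ChartedSpace E M] [IsManifold 𝓘(ℝ, E) ∞ M]

/-- Near each point, the coordinate vector fields of a chart extend to global smooth fields. -/
theorem exists_extend_coordinate_fields [T2Space M] (p : M) :
    ∃ (V : E →ₗ[ℝ] (Π x : M, TangentSpace 𝓘(ℝ, E) x)) (W : Set M), IsOpen W ∧ p ∈ W ∧
      W ⊆ (chartAt E p).source ∧
      (∀ w, ContMDiff 𝓘(ℝ, E) 𝓘(ℝ, E).tangent ∞
        (fun x ↦ (⟨x, V w x⟩ : TangentBundle 𝓘(ℝ, E) M))) ∧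
      ∀ x ∈ W, ∀ w, V w x = chartDerivInv (chartAt E p) x w := by
  have hfin : CompleteSpace E := FiniteDimensional.complete ℝ E
  let f : SmoothBumpFunction 𝓘(ℝ, E) p := Classical.arbitrary _
  obtain ⟨t, ht, hto, hpt⟩ := eventually_nhds_iff.1 f.eventuallyEq_one
  -- Flatness is tested on global smooth fields only, hence the cutoff of the coordinate fields by a
  -- bump function equal to 1 near p.
  refine ⟨⟨⟨fun w ↦ (f : M → ℝ) • lift (chartAt E p) (fun _ ↦ w), fun v w ↦ ?_⟩, fun c w ↦ ?_⟩,
    t ∩ (chartAt E p).source, hto.inter (chartAt E p).open_source, ⟨hpt, mem_chart_source E p⟩,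
    inter_subset_right, fun w ↦ ?_, fun x hx w ↦ ?_⟩
  · funext x
    simp [lift]
  · funext x
    simp [lift, smul_comm c]
  · refine ContMDiffOn.smul_section_of_tsupport (V := (TangentSpace 𝓘(ℝ, E) : M → Type _))
      (s := lift (chartAt E p) (fun _ ↦ w)) (u := (chartAt E p).source) f.contMDiff.contMDiffOn
      (chartAt E p).open_source f.tsupport_subset_chartAt_source fun x hx ↦ ?_
    exact (contMDiffAt_lift (IsManifold.chart_mem_maximalAtlas p) hx le_rfl
      contDiffAt_const).contMDiffWithinAt
  · change f x • lift (chartAt E p) (fun _ ↦ w) x = _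
    rw [ht x hx.1]
    simp [lift]

variable (cov : CovariantDerivative 𝓘(ℝ, E) E (TangentSpace 𝓘(ℝ, E) : M → Type _))
  (e : OpenPartialHomeomorph M E)
  {V : E →ₗ[ℝ] (Π x : M, TangentSpace 𝓘(ℝ, E) x)}
  (hV : ∀ w, ContMDiff 𝓘(ℝ, E) 𝓘(ℝ, E).tangent ∞
    (fun x ↦ (⟨x, V w x⟩ : TangentBundle 𝓘(ℝ, E) M)))

/-- The Christoffel form of a connection in a chart, with respect to vector fields extending the
coordinate fields. -/
noncomputable def christoffel (u : E) : E →L[ℝ] E →L[ℝ] E :=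
  -- Built as a linear map of the field index w, continuous by finite dimension; `flip` then puts
  -- the direction of differentiation first.
  (LinearMap.toContinuousLinearMap
    { toFun := fun w ↦ (chartDeriv e (e.symm u)).comp
        ((cov (V w) (e.symm u)).comp (chartDerivInv e (e.symm u)))
      map_add' := fun v w ↦ by
        rw [map_add, cov.isCovariantDerivativeOnUniv.add
          ((hV v).mdifferentiable (by simp) _) ((hV w).mdifferentiable (by simp) _)]
        ext; simp
      map_smul' := fun c w ↦ by
        rw [map_smul, cov.isCovariantDerivativeOnUniv.smul_const c
          ((hV w).mdifferentiable (by simp) _)]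
        ext; simp } : E →L[ℝ] E →L[ℝ] E).flip

theorem christoffel_apply (u v w : E) : christoffel cov e hV u v w =
    chartDeriv e (e.symm u) (cov (V w) (e.symm u) (chartDerivInv e (e.symm u) v)) := rfl

variable {e} {W : Set M} (he : e ∈ IsManifold.maximalAtlas 𝓘(ℝ, E) ∞ M) (hW : IsOpen W)
  (hWe : W ⊆ e.source) (hVW : ∀ x ∈ W, ∀ w, V w x = chartDerivInv e x w)
include he hW hWe hVW

omit [FiniteDimensional ℝ E] [IsManifold 𝓘(ℝ, E) ∞ M] in
theorem rep_extend_eventuallyEq {x : M} (hx : x ∈ W) (w : E) :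
    rep e (V w) =ᶠ[𝓝 (e x)] fun _ ↦ w := by
  have hxe := hWe hx
  filter_upwards [e.open_target.mem_nhds (e.map_source hxe),
    (e.continuousAt_symm (e.map_source hxe)).eventually_mem
      (by rw [e.left_inv hxe]; exact hW.mem_nhds hx)] with u hu hu'
  rw [rep, hVW _ hu', chartDeriv_chartDerivInv he (e.map_target hu)]

omit he in
theorem rep_covariantDerivative_eventuallyEq {x : M} (hx : x ∈ W) (v w : E) :
    rep e (fun y ↦ cov (V w) y (V v y)) =ᶠ[𝓝 (e x)] fun u ↦ christoffel cov e hV u v w := by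
  have hxe := hWe hx
  filter_upwards [(e.continuousAt_symm (e.map_source hxe)).eventually_mem
      (by rw [e.left_inv hxe]; exact hW.mem_nhds hx)] with u hu'
  rw [rep, christoffel_apply, hVW _ hu']

/-- The local expression of a covariant derivative in a chart. -/
theorem chartDeriv_covariantDerivative {x : M} (hx : x ∈ W) {Y : Π x : M, TangentSpace 𝓘(ℝ, E) x}
    (hY : MDifferentiableAt 𝓘(ℝ, E) 𝓘(ℝ, E).tangent
      (fun x ↦ (⟨x, Y x⟩ : TangentBundle 𝓘(ℝ, E) M)) x) (v : TangentSpace 𝓘(ℝ, E) x) :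
    chartDeriv e x (cov Y x v) = chartDeriv e x (flatCov e Y x v) +
      christoffel cov e hV (e x) (chartDeriv e x v) (chartDeriv e x (Y x)) := by
  have hfin : CompleteSpace E := FiniteDimensional.complete ℝ E
  have hxe := hWe hx
  have h1 := (cov.isCovariantDerivativeOn (s := W)).difference_apply
    ((isCovariantDerivativeOn_flatCov he).mono hWe) hx hY
  -- The difference of two connections is tensorial, so Y may be replaced by the coordinate field
  -- with the same value at x, whose flat derivative vanishes.
  have h2 := (cov.isCovariantDerivativeOn (s := W)).difference_apply
    ((isCovariantDerivativeOn_flatCov he).mono hWe) hx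
    ((hV (chartDeriv e x (Y x))).mdifferentiable (by simp) x)
  rw [hVW x hx, chartDerivInv_chartDeriv he hxe, h1, sub_eq_iff_eq_add] at h2
  rw [christoffel_apply, e.left_inv hxe, chartDerivInv_chartDeriv he hxe, h2]
  simp only [add_apply, sub_apply, map_add, map_sub]
  rw [chartDeriv_flatCov he hxe (Y := V _),
    (rep_extend_eventuallyEq he hW hWe hVW hx _).fderiv_eq]
  simp [add_comm]

theorem contDiffOn_christoffel [cov.ContMDiffCovariantDerivative ∞] :
    ContDiffOn ℝ ∞ (christoffel cov e hV) (e.target ∩ e.symm ⁻¹' W) := by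
  have hfin : CompleteSpace E := FiniteDimensional.complete ℝ E
  refine contDiffOn_clm_apply.2 fun v ↦ contDiffOn_clm_apply.2 fun w u hu ↦ ?_
  have hxe := hWe hu.2
  have h := rep_covariantDerivative_eventuallyEq cov hV hW hWe hVW hu.2 v w
  rw [e.right_inv hu.1] at h
  refine (ContDiffAt.congr_of_eventuallyEq ?_ h.symm).contDiffWithinAt
  rw [← e.right_inv hu.1]
  refine contDiffAt_rep he hxe le_rfl ?_
  have h1 := (CovariantDerivative.ContMDiffCovariantDerivative.contMDiff (cov := cov)
    (k := ∞)).contMDiff (contMDiffOn_univ.2 (hV w))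
  exact ContMDiffAt.clm_bundle_apply (contMDiffOn_univ.1 h1 _) (hV v _)

include hV in
theorem mlieBracket_extend {x : M} (hx : x ∈ W) (v w : E) :
    mlieBracket 𝓘(ℝ, E) (V v) (V w) x = 0 := by
  have hfin : CompleteSpace E := FiniteDimensional.complete ℝ E
  apply chartDeriv_injective he (hWe hx)
  rw [chartDeriv_mlieBracket he (hWe hx) ((hV v).mdifferentiable (by simp) x)
    ((hV w).mdifferentiable (by simp) x),
    (rep_extend_eventuallyEq he hW hWe hVW hx v).fderiv_eq,
    (rep_extend_eventuallyEq he hW hWe hVW hx w).fderiv_eq]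
  simp

/-- Coordinate fields commute, so zero torsion reads ∇_v ∂_w = ∇_w ∂_v. -/
theorem christoffel_symm (htors : cov.torsion = 0) {x : M} (hx : x ∈ W) (v w : E) :
    christoffel cov e hV (e x) v w = christoffel cov e hV (e x) w v := by
  have h := (cov.torsion_eq_zero_iff.1 htors)
    ((hV v).mdifferentiable (by simp) x) ((hV w).mdifferentiable (by simp) x)
  rw [mlieBracket_extend hV he hW hWe hVW hx] at h
  rw [christoffel_apply, christoffel_apply, e.left_inv (hWe hx), ← hVW x hx, ← hVW x hx,
    sub_eq_zero.1 h]

/-- On commuting coordinate fields the curvature is ∂_vΓ_w - ∂_wΓ_v + [Γ_v, Γ_w]. This is the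
integrability condition of dθ = θΓ. -/
theorem christoffel_curvature [cov.ContMDiffCovariantDerivative ∞] (hflat : cov.IsFlat)
    {x : M} (hx : x ∈ W) (v w : E) :
    fderiv ℝ (christoffel cov e hV) (e x) v w +
        christoffel cov e hV (e x) v * christoffel cov e hV (e x) w =
      fderiv ℝ (christoffel cov e hV) (e x) w v +
        christoffel cov e hV (e x) w * christoffel cov e hV (e x) v := by
  have hxe := hWe hx
  have hG : DifferentiableAt ℝ (christoffel cov e hV) (e x) :=
    ((contDiffOn_christoffel cov hV he hW hWe hVW).contDiffAt
      ((e.isOpen_inter_preimage_symm hW).mem_nhds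
        ⟨e.map_source hxe, by simpa [e.left_inv hxe] using hx⟩)).differentiableAt (by simp)
  have key : ∀ v w z : E, chartDeriv e x (cov (fun y ↦ cov (V z) y (V w y)) x (V v x)) =
      fderiv ℝ (christoffel cov e hV) (e x) v w z +
        christoffel cov e hV (e x) v (christoffel cov e hV (e x) w z) := fun v w z ↦ by
    have h1 := (CovariantDerivative.ContMDiffCovariantDerivative.contMDiff (cov := cov)
      (k := ∞)).contMDiff (contMDiffOn_univ.2 (hV z))
    have hY := (ContMDiffAt.clm_bundle_apply (contMDiffOn_univ.1 h1 x) (hV w x)).mdifferentiableAt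
      (by simp)
    have h2 := rep_covariantDerivative_eventuallyEq cov hV hW hWe hVW hx w z
    rw [chartDeriv_covariantDerivative cov hV he hW hWe hVW hx hY, chartDeriv_flatCov he hxe,
      h2.fderiv_eq, ← rep_apply_chart (Y := fun y ↦ cov (V z) y (V w y)) hxe, h2.eq_of_nhds,
      hVW x hx, chartDeriv_chartDerivInv he hxe]
    have h3 := ((hG.hasFDerivAt.clm_apply (hasFDerivAt_const w _)).clm_apply
      (hasFDerivAt_const z _)).fderiv
    rw [h3]
    simp
  ext z
  have h := hflat (V v) (V w) (V z) (hV v) (hV w) (hV z) x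
  rw [CovariantDerivative.curvatureAt, mlieBracket_extend hV he hW hWe hVW hx, map_zero, sub_zero,
    sub_eq_zero] at h
  have h' := congrArg (chartDeriv e x) h
  rw [key, key] at h'
  exact h'

omit he hW hWe hVW

/-- A smooth, torsion-free and flat connection is locally the flat connection of a chart. -/
theorem exists_flat_chart [T2Space M] [cov.ContMDiffCovariantDerivative ∞]
    (htors : cov.torsion = 0) (hflat : cov.IsFlat) (p : M) :
    ∃ e ∈ IsManifold.maximalAtlas 𝓘(ℝ, E) ∞ M, p ∈ e.source ∧
      ∀ x ∈ e.source, ∀ Y : Π x : M, TangentSpace 𝓘(ℝ, E) x,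
        MDifferentiableAt 𝓘(ℝ, E) 𝓘(ℝ, E).tangent
          (fun x ↦ (⟨x, Y x⟩ : TangentBundle 𝓘(ℝ, E) M)) x → cov Y x = flatCov e Y x := by
  have hfin : CompleteSpace E := FiniteDimensional.complete ℝ E
  obtain ⟨V, W, hW, hpW, hWe, hV, hVW⟩ := exists_extend_coordinate_fields (E := E) p
  set e := chartAt E p
  have he : e ∈ IsManifold.maximalAtlas 𝓘(ℝ, E) ∞ M := IsManifold.chart_mem_maximalAtlas p
  have hU : IsOpen (e.target ∩ e.symm ⁻¹' W) := e.isOpen_inter_preimage_symm hW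
  have hpU : e p ∈ e.target ∩ e.symm ⁻¹' W :=
    ⟨e.map_source (hWe hpW), by simpa [e.left_inv (hWe hpW)] using hpW⟩
  obtain ⟨φ, hpφ, hφU, hφ, hφ', hφG⟩ := exists_contDiffOn_fderiv_fderiv_eq hU
    (contDiffOn_christoffel cov hV he hW hWe hVW)
    (fun u hu v w ↦ by
      have := christoffel_symm cov hV he hW hWe hVW htors hu.2 v w
      rwa [e.right_inv hu.1] at this)
    (fun u hu v w ↦ by
      have := christoffel_curvature cov hV he hW hWe hVW hflat hu.2 v w
      rwa [e.right_inv hu.1] at this) hpU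
  have he' : e.trans φ ∈ IsManifold.maximalAtlas 𝓘(ℝ, E) ∞ M := by
    rw [IsManifold.mem_maximalAtlas_iff_contMDiffOn]
    constructor
    · rw [e.trans_source]
      exact hφ.contMDiffOn.comp ((contMDiffOn_of_mem_maximalAtlas he).mono inter_subset_left)
        fun x hx ↦ hx.2
    · rw [e.trans_target]
      exact (contMDiffOn_symm_of_mem_maximalAtlas he).comp
        (hφ'.contMDiffOn.mono inter_subset_left) fun x hx ↦ hx.2
  refine ⟨e.trans φ, he', by simpa [e.trans_source] using ⟨hWe hpW, hpφ⟩, fun x hx Y hY ↦ ?_⟩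
  have hx' := hx
  rw [e.trans_source] at hx'
  have hxe : x ∈ e.source := hx'.1
  have hxφ : e x ∈ φ.source := hx'.2
  have hxW : x ∈ W := by simpa [e.left_inv hxe] using (hφU hxφ).2
  have hτ : e.trans φ ∘ e.symm =ᶠ[𝓝 (e x)] φ := by
    filter_upwards [e.open_target.mem_nhds (e.map_source hxe)] with u hu
    simp [e.right_inv hu]
  ext1 v
  apply chartDeriv_injective he' hx
  have hd := chartDeriv_eq_fderiv_comp he he' hxe hx
  -- Passing from `e` to `e.trans φ` adds D²φ = Dφ(Γ), exactly the term by which `cov` exceeds the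
  -- flat connection of `e`.
  rw [chartDeriv_flatCov_transition he he' hxe hx hY, hτ.fderiv.fderiv_eq, hφG _ hxφ, hd,
    hτ.fderiv_eq, ContinuousLinearMap.comp_apply, ContinuousLinearMap.comp_apply,
    chartDeriv_covariantDerivative cov hV he hW hWe hVW hxW hY, map_add]

end FlatCharts

/-! ### Affine transitions and equality of flat connections -/

section AffineTransition

variable {E : Type*} [NormedAddCommGroup E] [NormedSpace ℝ E] [FiniteDimensional ℝ E]

theorem fderiv_affineMap (σ : E →ᵃ[ℝ] E) (u : E) :
    fderiv ℝ σ u = LinearMap.toContinuousLinearMap σ.linear := by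
  have h : (σ : E → E) = fun u ↦ LinearMap.toContinuousLinearMap σ.linear u + σ 0 :=
    σ.decomp
  rw [h]
  exact ((ContinuousLinearMap.hasFDerivAt _).add_const _).fderiv

omit [FiniteDimensional ℝ E] in
/-- A map with vanishing second derivative on a connected open set, whose first derivative is
bijective, is the restriction of an affine equivalence. -/
theorem exists_affineEquiv_eqOn {τ : E → E} {S : Set E} (hS : IsOpen S) (hc : IsPreconnected S)
    (hτ : ContDiffOn ℝ ∞ τ S) (h2 : ∀ u ∈ S, fderiv ℝ (fderiv ℝ τ) u = 0)
    (hb : ∀ u ∈ S, Function.Bijective (fderiv ℝ τ u)) : ∃ σ : E ≃ᵃ[ℝ] E, EqOn τ σ S := by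
  rcases S.eq_empty_or_nonempty with rfl | ⟨u₀, hu₀⟩
  · exact ⟨AffineEquiv.refl ℝ E, fun u hu ↦ hu.elim⟩
  have hd : DifferentiableOn ℝ τ S := hτ.differentiableOn (by simp)
  have hd' : DifferentiableOn ℝ (fderiv ℝ τ) S :=
    (hτ.fderiv_of_isOpen (m := 1) hS (by norm_cast)).differentiableOn one_ne_zero
  obtain ⟨D, hD⟩ := hS.exists_is_const_of_fderiv_eq_zero hc hd' h2
  have hd₀ : DifferentiableOn ℝ (fun u ↦ τ u - D u) S :=
    hd.sub D.differentiable.differentiableOn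
  obtain ⟨a, ha⟩ := hS.exists_is_const_of_fderiv_eq_zero hc hd₀ fun u hu ↦ by
    rw [fderiv_fun_sub (hd.differentiableAt (hS.mem_nhds hu)) D.differentiableAt, hD u hu]
    simp
  refine ⟨(LinearEquiv.ofBijective (D : E →ₗ[ℝ] E) (hD u₀ hu₀ ▸ hb u₀ hu₀)).toAffineEquiv.trans
    (AffineEquiv.constVAdd ℝ E a), fun u hu ↦ ?_⟩
  have := ha u hu
  simp only [AffineEquiv.trans_apply, LinearEquiv.coe_toAffineEquiv, LinearEquiv.ofBijective_apply,
    AffineEquiv.constVAdd_apply, vadd_eq_add, ContinuousLinearMap.coe_coe]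
  rw [← this, sub_add_cancel]

variable {M : Type*} [TopologicalSpace M] [ChartedSpace E M] [IsManifold 𝓘(ℝ, E) ∞ M]
  {e e' : OpenPartialHomeomorph M E} (he : e ∈ IsManifold.maximalAtlas 𝓘(ℝ, E) ∞ M)
  (he' : e' ∈ IsManifold.maximalAtlas 𝓘(ℝ, E) ∞ M)
include he he'

theorem flatCov_eq_of_affine_transition {σ : E ≃ᵃ[ℝ] E}
    (hσ : EqOn (e' ∘ e.symm) σ (e '' (e.source ∩ e'.source))) {x : M} (hx : x ∈ e.source)
    (hx' : x ∈ e'.source) {Y : Π x : M, TangentSpace 𝓘(ℝ, E) x}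
    (hY : MDifferentiableAt 𝓘(ℝ, E) 𝓘(ℝ, E).tangent
      (fun x ↦ (⟨x, Y x⟩ : TangentBundle 𝓘(ℝ, E) M)) x) : flatCov e' Y x = flatCov e Y x := by
  have hfin : CompleteSpace E := FiniteDimensional.complete ℝ E
  have hopen : IsOpen (e '' (e.source ∩ e'.source)) :=
    e.isOpen_image_of_subset_source (e.open_source.inter e'.open_source) inter_subset_left
  have hev : e' ∘ e.symm =ᶠ[𝓝 (e x)] σ :=
    hσ.eventuallyEq_of_mem (hopen.mem_nhds (mem_image_of_mem e ⟨hx, hx'⟩))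
  have h2 : fderiv ℝ (fderiv ℝ (e' ∘ e.symm)) (e x) = 0 := by
    rw [hev.fderiv.fderiv_eq,
      show fderiv ℝ (σ : E → E) = fun _ ↦ LinearMap.toContinuousLinearMap σ.toAffineMap.linear from
        funext (fderiv_affineMap σ.toAffineMap)]
    simp
  ext1 v
  apply chartDeriv_injective he' hx'
  rw [chartDeriv_flatCov_transition he he' hx hx' hY, h2]
  simp

/-- Two charts with the same flat connection differ by an affine map on each connected open
set. -/
theorem exists_affineEquiv_of_flatCov_eq {U : Set M} (hU : IsOpen U) (hc : IsPreconnected U)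
    (hUe : U ⊆ e.source) (hUe' : U ⊆ e'.source)
    (h : ∀ x ∈ U, ∀ Y : Π x : M, TangentSpace 𝓘(ℝ, E) x,
      MDifferentiableAt 𝓘(ℝ, E) 𝓘(ℝ, E).tangent
        (fun x ↦ (⟨x, Y x⟩ : TangentBundle 𝓘(ℝ, E) M)) x → flatCov e Y x = flatCov e' Y x) :
    ∃ σ : E ≃ᵃ[ℝ] E, ∀ x ∈ U, e' x = σ (e x) := by
  have hfin : CompleteSpace E := FiniteDimensional.complete ℝ E
  have h2 : ∀ x ∈ U, fderiv ℝ (fderiv ℝ (e' ∘ e.symm)) (e x) = 0 := fun x hx ↦ by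
    ext v w
    -- The field with constant components w isolates the value of D²τ at (v, w).
    have hY := (contMDiffAt_lift (k := ∞) he (hUe hx) le_rfl
      (contDiffAt_const (c := w))).mdifferentiableAt (by simp)
    have h1 := chartDeriv_flatCov_transition he he' (hUe hx) (hUe' hx) hY (chartDerivInv e x v)
    rw [h x hx _ hY, left_eq_add, chartDeriv_chartDerivInv he (hUe hx), lift,
      chartDeriv_chartDerivInv he (hUe hx)] at h1
    exact h1
  obtain ⟨σ, hσ⟩ := exists_affineEquiv_eqOn (τ := e' ∘ e.symm)
    (e.isOpen_image_of_subset_source hU hUe) (hc.image e (e.continuousOn.mono hUe))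
    (by
      rintro _ ⟨x, hx, rfl⟩
      exact (contDiffAt_transition he he' (hUe hx) (hUe' hx)).contDiffWithinAt)
    (by
      rintro _ ⟨x, hx, rfl⟩
      exact h2 x hx)
    (by
      rintro _ ⟨x, hx, rfl⟩
      exact fderiv_transition_bijective he he' (hUe hx) (hUe' hx))
  refine ⟨σ, fun x hx ↦ ?_⟩
  rw [← hσ (mem_image_of_mem e hx), Function.comp_apply, e.left_inv (hUe hx)]

end AffineTransition

/-! ### Refinement of covers -/

/-- In a paracompact Hausdorff space, every family of neighbourhoods can be refined so that any two
members that meet lie together in one member of the original family. -/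
theorem exists_nhds_pairwise_refinement {X : Type*} [TopologicalSpace X] [T2Space X]
    [ParacompactSpace X] {W : X → Set X} (hW : ∀ x, IsOpen (W x)) (hxW : ∀ x, x ∈ W x) :
    ∃ N : X → Set X, (∀ x, N x ∈ 𝓝 x) ∧
      ∀ x y, (N x ∩ N y).Nonempty → ∃ i, N x ⊆ W i ∧ N y ⊆ W i := by
  obtain ⟨v, hv, hvc, hvf, hvW⟩ := precise_refinement W hW
    (eq_univ_of_forall fun x ↦ mem_iUnion.2 ⟨x, hxW x⟩)
  obtain ⟨C, hCc, hC, hCv⟩ := exists_iUnion_eq_closed_subset hv hvf.point_finite hvc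
  -- With closed `C i ⊆ v i` still covering, N x lies in every `v i` with x ∈ C i and avoids every
  -- other `C i`; local finiteness makes it a neighbourhood. If z is in N x and N y and z ∈ C i,
  -- then x and y are in `C i`, so both sets lie in `v i ⊆ W i`.
  refine ⟨fun x ↦ (⋂ i ∈ {i | x ∈ C i}, v i) ∩ ⋂ (i) (_ : x ∉ C i), (C i)ᶜ, fun x ↦ ?_,
    fun x y ⟨z, hzx, hzy⟩ ↦ ?_⟩
  · refine Filter.inter_mem ?_ ((hvf.subset hCv).iInter_compl_mem_nhds hC x)
    refine (Filter.biInter_mem ((hvf.point_finite x).subset fun i hi ↦ hCv i hi)).2 fun i hi ↦ ?_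
    exact (hv i).mem_nhds (hCv i hi)
  · obtain ⟨i, hi⟩ := mem_iUnion.1 (hCc ▸ mem_univ z)
    have key : ∀ x, z ∈ (⋂ i ∈ {i | x ∈ C i}, v i) ∩ ⋂ (i) (_ : x ∉ C i), (C i)ᶜ →
        (⋂ i ∈ {i | x ∈ C i}, v i) ∩ ⋂ (i) (_ : x ∉ C i), (C i)ᶜ ⊆ W i := fun x hz y hy ↦ by
      have hxi : x ∈ C i := by
        by_contra hxi
        exact mem_iInter₂.1 hz.2 i hxi hi
      exact hvW i (mem_iInter₂.1 hy.1 i hxi)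
    exact ⟨i, key x hzx, key y hzy⟩

/-! ### Construction of affine atlases -/

section AffineAtlas

variable {n : ℕ} {M : Type*} [TopologicalSpace M] [ChartedSpace (EuclideanSpace ℝ (Fin n)) M]

/-- Every affine atlas is contained in a maximal one. -/
theorem admitsAffineStructure_of_isAffineAtlas
    {A : Set (OpenPartialHomeomorph M (EuclideanSpace ℝ (Fin n)))} (hA : IsAffineAtlas n M A) :
    AdmitsAffineStructure n M := by
  obtain ⟨B, -, hB⟩ := zorn_subset_nonempty {A | IsAffineAtlas n M A} (fun c hc hchain hne ↦ by
    refine ⟨⋃₀ c, ⟨sUnion_subset fun s hs ↦ (hc hs).smooth, fun p ↦ ?_, ?_⟩,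
      fun s hs ↦ subset_sUnion_of_mem hs⟩
    · obtain ⟨s, hs⟩ := hne
      obtain ⟨e, he, hp⟩ := (hc hs).cover p
      exact ⟨e, ⟨s, hs, he⟩, hp⟩
    · rintro e ⟨s, hs, he⟩ e' ⟨t, ht, he'⟩
      rcases hchain.total hs ht with hst | hts
      · exact (hc ht).affine e (hst he) e' he'
      · exact (hc hs).affine e he e' (hts he')) A hA
  exact ⟨B, hB⟩

variable [T2Space M] [ParacompactSpace M] [IsManifold (𝓡 n) ∞ M]

theorem exists_isAffineAtlas_of_flat_charts
    (F : M → OpenPartialHomeomorph M (EuclideanSpace ℝ (Fin n)))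
    (hF : ∀ p, F p ∈ IsManifold.maximalAtlas (𝓡 n) ∞ M) (hpF : ∀ p, p ∈ (F p).source)
    (hagree : ∀ p q, ∀ x ∈ (F p).source ∩ (F q).source, ∀ Y : Π x : M, TangentSpace (𝓡 n) x,
      MDifferentiableAt (𝓡 n) (𝓡 n).tangent (fun x ↦ (⟨x, Y x⟩ : TangentBundle (𝓡 n) M)) x →
        flatCov (F p) Y x = flatCov (F q) Y x) :
    ∃ A, IsAffineAtlas n M A := by
  have hlc : LocallyConnectedSpace M :=
    ChartedSpace.locallyConnectedSpace (EuclideanSpace ℝ (Fin n)) M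
  obtain ⟨N, hN, hNN⟩ := exists_nhds_pairwise_refinement (fun p ↦ (F p).open_source) hpF
  have hNi : ∀ x, ∃ i, N x ⊆ (F i).source := fun x ↦ by
    obtain ⟨i, hi, -⟩ := hNN x x ⟨x, mem_of_mem_nhds (hN x), mem_of_mem_nhds (hN x)⟩
    exact ⟨i, hi⟩
  choose i hi using hNi
  have hU : ∀ x, ∃ U ⊆ N x, IsOpen U ∧ x ∈ U ∧ IsConnected U := fun x ↦
    locallyConnectedSpace_iff_subsets_isOpen_isConnected.1 hlc x (N x) (hN x)
  choose U hUN hUo hxU hUc using hU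
  have hsource : ∀ x, ((F (i x)).restr (U x)).source = U x := fun x ↦ by
    rw [OpenPartialHomeomorph.restr_source, (hUo x).interior_eq]
    exact inter_eq_right.2 ((hUN x).trans (hi x))
  refine ⟨range fun x ↦ (F (i x)).restr (U x), ?_, fun p ↦ ⟨_, mem_range_self p, ?_⟩, ?_⟩
  · rintro _ ⟨x, rfl⟩
    exact restr_mem_maximalAtlas (contDiffGroupoid ∞ (𝓡 n)) (hF (i x)) (hUo x)
  · rw [hsource]; exact hxU p
  · rintro _ ⟨x, rfl⟩ _ ⟨y, rfl⟩
    rcases (U x ∩ U y).eq_empty_or_nonempty with hemp | hne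
    · refine ⟨AffineEquiv.refl ℝ _, ?_⟩
      rw [hsource, hsource, hemp, image_empty]
      exact eqOn_empty _ _
    -- `U x ∩ U y` may be disconnected, so its two charts are not compared there. Each is compared
    -- with `F j` on its own connected domain, and the composite is one affine map for the whole
    -- overlap.
    obtain ⟨j, hxj, hyj⟩ := hNN x y (hne.mono (inter_subset_inter (hUN x) (hUN y)))
    have key : ∀ z, N z ⊆ (F j).source →
        ∃ σ : EuclideanSpace ℝ (Fin n) ≃ᵃ[ℝ] EuclideanSpace ℝ (Fin n),
          ∀ w ∈ U z, F j w = σ (F (i z) w) := fun z hz ↦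
      exists_affineEquiv_of_flatCov_eq (hF (i z)) (hF j) (hUo z) (hUc z).isPreconnected
        ((hUN z).trans (hi z)) ((hUN z).trans hz) fun w hw ↦
          hagree (i z) j w ⟨hi z (hUN z hw), hz (hUN z hw)⟩
    obtain ⟨σ, hσ⟩ := key x hxj
    obtain ⟨σ', hσ'⟩ := key y hyj
    refine ⟨σ.trans σ'.symm, ?_⟩
    rintro _ ⟨w, hw, rfl⟩
    rw [Function.comp_apply, OpenPartialHomeomorph.left_inv _ hw.1]
    rw [hsource, hsource] at hw
    change F (i y) w = σ'.symm (σ (F (i x) w))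
    rw [← hσ w hw.1, hσ' w hw.2, AffineEquiv.symm_apply_apply]

end AffineAtlas

end AffineStructure

open AffineStructure

theorem theorem1 (n : ℕ) (M : Type*) [TopologicalSpace M] [T2Space M] [ParacompactSpace M]
    [ChartedSpace (EuclideanSpace ℝ (Fin n)) M] [IsManifold (𝓡 n) ∞ M] :
    AdmitsAffineStructure n M ↔
      ∃ cov : CovariantDerivative (𝓡 n) (EuclideanSpace ℝ (Fin n))
          (TangentSpace (𝓡 n) : M → Type _),
        CovariantDerivative.ContMDiffCovariantDerivative cov ∞ ∧ cov.torsion = 0 ∧ cov.IsFlat := by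
  constructor
  · rintro ⟨A, hA, -⟩
    choose c hcA hxc using hA.cover
    have hc : ∀ x, c x ∈ IsManifold.maximalAtlas (𝓡 n) ∞ M := fun x ↦ hA.smooth (hcA x)
    have hagree : ∀ x, ∀ y ∈ (c x).source, ∀ Y : Π x : M, TangentSpace (𝓡 n) x,
        MDifferentiableAt (𝓡 n) (𝓡 n).tangent
          (fun x ↦ (⟨x, Y x⟩ : TangentBundle (𝓡 n) M)) y →
        flatCov (c y) Y y = flatCov (c x) Y y := fun x y hy Y hY ↦ by
      obtain ⟨σ, hσ⟩ := hA.affine (c x) (hcA x) (c y) (hcA y)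
      exact flatCov_eq_of_affine_transition (hc x) (hc y) hσ hy (hxc y) hY
    exact ⟨gluedCov c hc hxc, contMDiff_gluedCov c hc hxc hagree, torsion_gluedCov c hc hxc,
      isFlat_gluedCov c hc hxc hagree⟩
  · rintro ⟨cov, hsmooth, htors, hflat⟩
    choose F hF hpF hcov using exists_flat_chart cov htors hflat
    obtain ⟨A, hA⟩ := exists_isAffineAtlas_of_flat_charts F hF hpF fun p q x hx Y hY ↦
      (hcov p x hx.1 Y hY).symm.trans (hcov q x hx.2 Y hY)
    exact admitsAffineStructure_of_isAffineAtlas hA
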